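/- Let $\Lambda=\mathbb Z\omega_1+\mathbb Z\omega_2\subset\mathbb C$ be a lattice with Weierstrass functions $\wp$ and $\zeta$, and suppose that its invariants $g_2=60\sum_{0\ne\omega\in\Lambda}\omega^{-4}$ and $g_3=140\sum_{0\ne\omega\in\Lambda}\omega^{-6}$ are algebraic. Let $\eta_i=\zeta(z+\omega_i)-\zeta(z)$ be the quasi-periods, and let $K=\mathbb Q(\{\alpha\in\mathbb C:\alpha\Lambda\subseteq\Lambda\})$ be the field of endomorphisms of $\Lambda$. Assume that at least one of the following two statements holds for $\Lambda$. (a) (Elliptic Schanuel conjecture for $\Lambda$.) For all $n\ge 1$ and all $x_1,\dots,x_n\in\mathbb C\setminus\Lambda$ that are linearly independent over $K$ modulo the $K$-span $K\Lambda$ of $\Lambda$ (that is, whose classes in $\mathbb C/K\Lambda$ are linearly independent over $K$), $$\operatorname{trdeg}_{\mathbb Q}\mathbb Q\big(g_2,g_3,\omega_1,\omega_2,\eta_1,\eta_2,x_1,\dots,x_n,\wp(x_1),\dots,\wp(x_n),\zeta(x_1),\dots,\zeta(x_n)\big)\ \ge\ 2n+\frac{4}{[K:\mathbb Q]}.$$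 (b) (Weak elliptic Schanuel conjecture for $\Lambda$.) For all $n\ge 1$ and all $x_1,\dots,x_n\in\mathbb C\setminus\Lambda$ that are linearly independent over $K$, $$\operatorname{trdeg}_{\mathbb Q}\mathbb Q\big(g_2,g_3,x_1,\dots,x_n,\wp(x_1),\dots,\wp(x_n)\big)\ \ge\ n.$$ For a subfield $F\subseteq\mathbb C$ let $\overline F$ denote its algebraic closure in $\mathbb C$. Define $\mathcal E_0=\overline{\mathbb Q}$, $\mathcal L_0=\overline{\mathbb Q(\Lambda)}$ and, for $n\ge 1$, $$\mathcal E_n=\overline{\mathcal E_{n-1}\big(\{\wp(x):x\in\mathcal E_{n-1}\setminus\Lambda\}\big)},\qquad \mathcal L_n=\overline{\mathcal L_{n-1}\big(\{x\in\mathbb C:\wp(x)\in\mathcal L_{n-1}\cup\{\infty\}\}\big)},$$ where $\wp(x)=\infty$ means $x\in\Lambda$, and put $\mathcal E=\bigcup_{n\ge 0}\mathcal E_n$ and $\mathcal L=\bigcup_{n\ge 0}\mathcal L_n$. Then $\mathcal E$ and $\mathcal L$ are linearly disjoint over $\overline{\mathbb Q}$. Consequently no nonzero $\omega\in\Lambda$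 lies in $\mathcal E$. -/

import Mathlib

noncomputable section

/-- The field `Q̄` of algebraic numbers, as a subfield of `ℂ`. -/
abbrev Qbar : IntermediateField ℚ ℂ := algebraicClosure ℚ ℂ

/-- The algebraic closure in `ℂ` of the field `Q̄(S)` generated by a set `S` of complex numbers. -/
def algClosureAdjoin (S : Set ℂ) : IntermediateField Qbar ℂ :=
  (algebraicClosure (IntermediateField.adjoin Qbar S) ℂ).restrictScalars Qbar

theorem subset_algClosureAdjoin (S : Set ℂ) : S ⊆ (algClosureAdjoin S : Set ℂ) := by
  intro x hx
  have hx' : x ∈ IntermediateField.adjoin Qbar S := IntermediateField.subset_adjoin _ _ hx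
  exact (algebraicClosure (IntermediateField.adjoin Qbar S) ℂ).algebraMap_mem ⟨x, hx'⟩

namespace PeriodPair

variable (L : PeriodPair)

/-- The Weierstrass zeta function
`ζ(z) = 1 / z + ∑_{l ∈ Λ, l ≠ 0} (1 / (z - l) + 1 / l + z / l ^ 2)`.
The term `1 / z` is the summand at `l = 0`, because `1 / 0 = 0` and `z / 0 = 0`. -/
def weierstrassZeta (z : ℂ) : ℂ :=
  ∑' l : L.lattice, (1 / (z - l) + 1 / (l : ℂ) + z / (l : ℂ) ^ 2)

/-- The quasi-period `ζ(z + ω) - ζ(z)` attached to a period `ω`. It does not depend on the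
choice of `z ∉ Λ`. It is evaluated here at `z = -ω / 2`, which is not in `Λ` if `ω` belongs to
a basis of `Λ`. -/
def quasiPeriod (ω : ℂ) : ℂ :=
  L.weierstrassZeta (-ω / 2 + ω) - L.weierstrassZeta (-ω / 2)

/-- The field of endomorphisms of the lattice: the subfield of `ℂ` generated by
the complex numbers `α` with `α Λ ⊆ Λ`. -/
def endField : IntermediateField ℚ ℂ :=
  IntermediateField.adjoin ℚ {α : ℂ | ∀ ω ∈ L.lattice, α * ω ∈ L.lattice}

/-- The elliptic Schanuel conjecture for the lattice `Λ`: if `x₁, …, xₙ ∈ ℂ ∖ Λ` are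
linearly independent over `K` modulo the `K`-span of `Λ`, where `K` is the field of endomorphisms,
then `ℚ(g₂, g₃, ω₁, ω₂, η₁, η₂, xᵢ, ℘(xᵢ), ζ(xᵢ))` has transcendence degree at least
`2 n + 4 / [K : ℚ]`. As `[K : ℚ]` is `1` or `2`, the division is exact. -/
def EllipticSchanuel : Prop :=
  ∀ (n : ℕ) (x : Fin n → ℂ), 1 ≤ n → (∀ i, x i ∉ L.lattice) →
    LinearIndependent L.endField
      (fun i => (Submodule.span L.endField (L.lattice : Set ℂ)).mkQ (x i)) →
    ((2 * n + 4 / Module.finrank ℚ L.endField : ℕ) : Cardinal) ≤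
      Algebra.trdeg ℚ (IntermediateField.adjoin ℚ
        ({L.g₂, L.g₃, L.ω₁, L.ω₂, L.quasiPeriod L.ω₁, L.quasiPeriod L.ω₂} ∪
          Set.range x ∪ Set.range (fun i => L.weierstrassP (x i)) ∪
          Set.range (fun i => L.weierstrassZeta (x i)) : Set ℂ))

/-- The weak elliptic Schanuel conjecture for the lattice `Λ`: if `x₁, …, xₙ ∈ ℂ ∖ Λ` are
linearly independent over the field of endomorphisms, then
`ℚ(g₂, g₃, xᵢ, ℘(xᵢ))` has transcendence degree at least `n`. -/
def WeakEllipticSchanuel : Prop :=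
  ∀ (n : ℕ) (x : Fin n → ℂ), 1 ≤ n → (∀ i, x i ∉ L.lattice) →
    LinearIndependent L.endField x →
    (n : Cardinal) ≤
      Algebra.trdeg ℚ (IntermediateField.adjoin ℚ
        ({L.g₂, L.g₃} ∪ Set.range x ∪ Set.range (fun i => L.weierstrassP (x i)) : Set ℂ))

/-- The fields `E₀ = Q̄` and `Eₙ₊₁`, the algebraic closure of
`Eₙ(℘(x) : x ∈ Eₙ ∖ Λ)`. -/
def towerE : ℕ → IntermediateField Qbar ℂ
  | 0 => ⊥
  | n + 1 => algClosureAdjoin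
      ((towerE n : Set ℂ) ∪ L.weierstrassP '' ((towerE n : Set ℂ) \ (L.lattice : Set ℂ)))

/-- The fields `L₀`, the algebraic closure of `ℚ(Λ)`, and `Lₙ₊₁`, the algebraic closure of
`Lₙ(x : ℘(x) ∈ Lₙ ∪ {∞})`. Here `℘(x) = ∞` means `x ∈ Λ`. -/
def towerL : ℕ → IntermediateField Qbar ℂ
  | 0 => algClosureAdjoin (L.lattice : Set ℂ)
  | n + 1 => algClosureAdjoin
      ((towerL n : Set ℂ) ∪ {x : ℂ | x ∈ L.lattice ∨ L.weierstrassP x ∈ towerL n})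

theorem towerE_mono : Monotone L.towerE :=
  monotone_nat_of_le_succ fun _ _ hx => subset_algClosureAdjoin _ (Or.inl hx)

theorem towerL_mono : Monotone L.towerL :=
  monotone_nat_of_le_succ fun _ _ hx => subset_algClosureAdjoin _ (Or.inl hx)

/-- The union `E` of the increasing sequence of fields `Eₙ`. -/
def fieldE : IntermediateField Qbar ℂ := ⨆ n, L.towerE n

/-- The union `L` of the increasing sequence of fields `Lₙ`. -/
def fieldL : IntermediateField Qbar ℂ := ⨆ n, L.towerL n

theorem coe_fieldE : (L.fieldE : Set ℂ) = ⋃ n, (L.towerE n : Set ℂ) :=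
  IntermediateField.coe_iSup_of_directed L.towerE_mono.directed_le

theorem coe_fieldL : (L.fieldL : Set ℂ) = ⋃ n, (L.towerL n : Set ℂ) :=
  IntermediateField.coe_iSup_of_directed L.towerL_mono.directed_le

end PeriodPair

end

/-!
The proof rests on one inequality, `PeriodPair.RankInequality`: if a finite-dimensional space `Y`
over the field `K` of endomorphisms, together with all values of `℘` on `Y`, is algebraic over a
set of `r` numbers, then `dim Y ≤ r`.

* The weak conjecture gives it at once for a basis of `Y` that avoids `Λ`. The elliptic conjecture
  gives it for a basis of `Y` modulo the span `T` of the lattice: the numbers `ζ(xᵢ)` and the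
  quasi-periods are added to the generators, and the bound `2 n + 4 / [K : ℚ]` is exactly large
  enough to pay for them and for `Y ∩ T`. With complex multiplication only one quasi-period may be
  added, so the other one has to be algebraic over it and the periods. This is Masser's relation,
  proved in `exists_multiplier_relation_quasiPeriods` by integrating the identity
  `α² ℘(α z) = ∑ ℘(z + q) + κ`, where `q` runs through `α⁻¹ Λ / Λ`.
* The inequality is useful because, for an algebraically closed field `F` containing `g₂` and
  `g₃`, the points at which `℘` takes a value in `F ∪ {∞}` form a vector space over `K`
  (`PeriodPair.pointsSubmodule`). No explicit addition theorem or isogeny formula is used for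
  that. The functions `℘(z)` and `℘(α z + w)` are algebraically dependent by a dimension count; if
  `℘(w)` and `α` lie in `F`, Taylor expansion at `0` gives a dependence with coefficients in `F`;
  and an irreducible such relation can be specialised at any point
  (`weierstrassP_affine_mem_iff`).
* Linear disjointness of `Eₘ` and the field `L` follows by induction on `m`. Finite subsets of
  `Eₘ₊₁` and of `L` are algebraic over `℘(A)` and over `B`, for finite sets `A ⊆ Eₘ` and `B ⊆ L`,
  where `A` is algebraic over `℘(A)` and `℘(B)` over `B`. The induction hypothesis makes the spans
  of `A` and `B` independent up to algebraic numbers, and the rank inequality for their sum shows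
  that suitable generators are algebraically independent
  (`RankInequality.exists_algebraicIndependent`).
* Algebraic independence of generators implies linear disjointness of the algebraic closures of
  the fields they generate over `Q̄` (`linearDisjoint_of_exists_algebraicIndependent`), by a
  specialisation argument based on the Nullstellensatz.

A nonzero period in both fields would be algebraic, by linear disjointness, and the rank
inequality for the line that it spans, with `r = 0`, excludes this.
-/

noncomputable section

open Filter Topology

/-! ### Linear algebra -/

theorem exists_disjoint_sup_eq {K V : Type*} [Field K] [AddCommGroup V] [Module K V]
    {A B : Submodule K V} (h : A ≤ B) : ∃ W, Disjoint A W ∧ A ⊔ W = B := by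
  obtain ⟨C, hC⟩ := Submodule.exists_isCompl A
  refine ⟨C ⊓ B, hC.disjoint.mono_right inf_le_left, ?_⟩
  rw [← sup_inf_assoc_of_le C h, hC.sup_eq_top, top_inf_eq]

theorem finrank_add_of_disjoint {K V : Type*} [Field K] [AddCommGroup V] [Module K V]
    {A W B : Submodule K V} [FiniteDimensional K B] (h : Disjoint A W) (hB : A ⊔ W = B) :
    Module.finrank K A + Module.finrank K W = Module.finrank K B := by
  have : FiniteDimensional K A := Submodule.finiteDimensional_of_le (hB ▸ le_sup_left)
  have : FiniteDimensional K W := Submodule.finiteDimensional_of_le (hB ▸ le_sup_right)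
  have := Submodule.finrank_sup_add_finrank_inf_eq A W
  rw [h.eq_bot, finrank_bot, hB] at this
  omega

/-! ### Linear independence over a field of constants extended by independent elements -/

/-- The weak Nullstellensatz, in terms of points of an algebra of finite type. -/
theorem nonempty_algHom_of_finiteType (k R : Type*) [Field k] [IsAlgClosed k] [CommRing R]
    [Nontrivial R] [Algebra k R] [Algebra.FiniteType k R] : Nonempty (R →ₐ[k] k) := by
  obtain ⟨m, hm⟩ := Ideal.exists_maximal R
  let := Ideal.Quotient.field m
  have : Module.Finite k (R ⧸ m) := finite_of_finite_type_of_isJacobsonRing k (R ⧸ m)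
  have hb := IsAlgClosed.algebraMap_bijective_of_isIntegral (k := k) (K := R ⧸ m)
  exact ⟨(AlgEquiv.ofBijective (Algebra.ofId k (R ⧸ m)) hb).symm.toAlgHom.comp
    (Ideal.Quotient.mkₐ k m)⟩

open MvPolynomial IntermediateField.algebraAdjoinAdjoin in
/-- Elements `a i` that are algebraic over `k(s)` and linearly independent over `k` remain
linearly independent over `B` when `s` is algebraically independent over `B`. Here `A₀` stands for
`k(s)`; the only property of it that matters is that finitely many elements have a common
denominator `D` with numerators that are polynomials in `s`.

If `∑ i, b i * a i = 0`, the matrix of multiplication by `∑ i, b i * a i`, taken formally over the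
polynomials in `s` with coefficients in the algebra generated by the `b i` and `(b i₀)⁻¹`, is
singular. A specialisation of this algebra to `k` produces a `k`-linear combination of the `a i`
with norm zero in which the coefficient of `a i₀` does not vanish. -/
theorem eq_zero_of_sum_mul_eq_zero_of_common_denominators {k A₀ K σ ι : Type*} [Field k]
    [IsAlgClosed k] [Field A₀] [Field K] [Algebra k A₀] [Algebra A₀ K] [Algebra k K]
    [IsScalarTower k A₀ K] [Fintype ι] {s : σ → K} (B : IntermediateField k K)
    (hs : AlgebraicIndependent B s)
    (hden : ∀ (n : ℕ) (f : ι × Fin n × Fin n → A₀), ∃ D : A₀, D ≠ 0 ∧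
      ∀ x, ∃ m : MvPolynomial σ k, aeval s m = algebraMap A₀ K (D * f x))
    {a : ι → K} (ha : ∀ i, IsAlgebraic A₀ (a i)) (hli : LinearIndependent k a)
    (b : ι → B) (h : ∑ i, (b i : K) * a i = 0) : b = 0 := by
  classical
  by_contra hb
  obtain ⟨i₀, hi₀⟩ := Function.ne_iff.mp hb
  -- specialise the coefficients
  let R : Subalgebra k B := Algebra.adjoin k (insert (b i₀)⁻¹ (Set.range b))
  have hRb (i) : b i ∈ R := Algebra.subset_adjoin (Or.inr ⟨i, rfl⟩)
  have : Algebra.FiniteType k R :=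
    (Subalgebra.fg_iff_finiteType R).1
      (Subalgebra.fg_def.2 ⟨_, (Set.finite_range b).insert _, rfl⟩)
  obtain ⟨φ⟩ := nonempty_algHom_of_finiteType k R
  let b' : ι → R := fun i => ⟨b i, hRb i⟩
  have hφ : φ (b' i₀) ≠ 0 := by
    have : b' i₀ * ⟨(b i₀)⁻¹, Algebra.subset_adjoin (Or.inl rfl)⟩ = 1 :=
      Subtype.ext (mul_inv_cancel₀ hi₀)
    intro h0
    simpa [h0] using congrArg φ this
  have hsR : AlgebraicIndependent R s :=
    hs.restrictScalars (R := R) (K := B) Subtype.val_injective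
  -- the matrices of multiplication by the `a i`
  let A₁ := IntermediateField.adjoin A₀ (Set.range a)
  have : FiniteDimensional A₀ A₁ :=
    IntermediateField.finiteDimensional_adjoin (fun x hx => by
      obtain ⟨i, rfl⟩ := hx
      exact (ha i).isIntegral)
  let e := Module.finBasis A₀ A₁
  let α : ι → A₁ := fun i => ⟨a i, IntermediateField.subset_adjoin _ _ ⟨i, rfl⟩⟩
  let M := fun i => Algebra.leftMulMatrix e (α i)
  obtain ⟨D, hD0, hD⟩ := hden _ (fun x => M x.1 x.2.1 x.2.2)
  have hD' : ∀ i p q, ∃ m : MvPolynomial σ k, aeval s m = (algebraMap A₀ K D) *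
      (algebraMap A₀ K (M i p q)) := fun i p q => by
    simpa using hD (i, p, q)
  choose m hm using hD'
  let v : Fin (Module.finrank A₀ A₁) → K := fun p => (e p : K)
  have hv (i q) : ∑ p, v p * algebraMap A₀ K (M i p q) = a i * v q := by
    have h1 : α i * e q = ∑ p, M i p q • e p := by
      have := e.sum_repr (α i * e q)
      simp only [M, Algebra.leftMulMatrix_eq_repr_mul]
      exact this.symm
    have h2 := congrArg (fun z : A₁ => (z : K)) h1
    simp only [MulMemClass.coe_mul] at h2
    rw [h2, AddSubmonoidClass.coe_finsetSum]
    refine Finset.sum_congr rfl fun p _ => ?_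
    simp [v, Algebra.smul_def, mul_comm]
  let N : Matrix _ _ (MvPolynomial σ R) := Matrix.of fun p q =>
    ∑ i, C (b' i) * MvPolynomial.map (algebraMap k R) (m i p q)
  have hNdet : N.det = 0 := by
    apply (algebraicIndependent_iff_injective_aeval.1 hsR)
    rw [map_zero, AlgHom.map_det]
    rw [← Matrix.exists_vecMul_eq_zero_iff]
    refine ⟨v, ?_, ?_⟩
    · intro h0
      have : Nontrivial A₁ := inferInstance
      have hpos : 0 < Module.finrank A₀ A₁ := Module.finrank_pos
      have := congrFun h0 ⟨0, hpos⟩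
      exact e.ne_zero ⟨0, hpos⟩ (Subtype.ext this)
    · ext q
      have : ∀ p, (aeval s (N p q) : K) =
          ∑ i, (b i : K) * (algebraMap A₀ K D * algebraMap A₀ K (M i p q)) := by
        intro p
        simp only [N, Matrix.of_apply, map_sum, map_mul, aeval_C, aeval_map_algebraMap, hm]
        rfl
      simp only [Matrix.vecMul, dotProduct, AlgHom.mapMatrix_apply, Matrix.map_apply, this,
        Pi.zero_apply]
      calc ∑ p, v p * ∑ i, (b i : K) * (algebraMap A₀ K D * algebraMap A₀ K (M i p q))
          = ∑ i, (b i : K) * algebraMap A₀ K D * ∑ p, v p * algebraMap A₀ K (M i p q) := by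
            simp_rw [Finset.mul_sum]
            rw [Finset.sum_comm]
            refine Finset.sum_congr rfl fun i _ => Finset.sum_congr rfl fun p _ => by ring
        _ = algebraMap A₀ K D * v q * ∑ i, (b i : K) * a i := by
            simp_rw [hv, Finset.mul_sum]
            refine Finset.sum_congr rfl fun i _ => by ring
        _ = 0 := by rw [h, mul_zero]
  have hspec : (∑ i, φ (b' i) • α i) = 0 := by
    rw [← Algebra.norm_eq_zero_iff (R := A₀), Algebra.norm_eq_matrix_det e]
    have h1 := congrArg (fun z => aeval s (MvPolynomial.map (φ : R →+* k) z)) hNdet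
    simp only [map_zero, RingHom.map_det, AlgHom.map_det] at h1
    have h2 : (aeval s : MvPolynomial σ k →ₐ[k] K).mapMatrix
        ((MvPolynomial.map (φ : R →+* k)).mapMatrix N) =
        (algebraMap A₀ K).mapMatrix (D •
          Algebra.leftMulMatrix e (∑ i, φ (b' i) • α i)) := by
      ext p q
      have hφk (x : k) : φ (algebraMap k R x) = x := φ.commutes x
      have h3 : Algebra.leftMulMatrix e (∑ i, φ (b' i) • α i) p q =
          ∑ i, (algebraMap k A₀ (φ (b' i))) * M i p q := by
        rw [map_sum, Matrix.sum_apply]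
        refine Finset.sum_congr rfl fun i _ => ?_
        rw [← algebraMap_smul A₀ (φ (b' i)) (α i), map_smul]
        rfl
      simp only [AlgHom.mapMatrix_apply, RingHom.mapMatrix_apply, Matrix.map_apply]
      rw [Matrix.smul_apply, h3]
      simp only [N, Matrix.of_apply, map_sum, map_mul, map_C, aeval_C, smul_eq_mul,
        MvPolynomial.map_map, Finset.mul_sum]
      refine Finset.sum_congr rfl fun i _ => ?_
      have : ((φ : R →+* k).comp (algebraMap k R)) = RingHom.id k := RingHom.ext hφk
      rw [this, MvPolynomial.map_id, hm]
      rw [← IsScalarTower.algebraMap_apply k A₀ K]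
      exact mul_left_comm _ _ _
    rw [h2, ← RingHom.map_det, Matrix.det_smul] at h1
    have h4 := (map_eq_zero _).1 h1
    exact (mul_eq_zero.1 h4).resolve_left (pow_ne_zero _ hD0)
  have h6 : ∑ i, φ (b' i) • a i = 0 := by
    have := congrArg (fun z : A₁ => (z : K)) hspec
    simpa [α] using! this
  exact hφ (Fintype.linearIndependent_iff.1 hli _ h6 i₀)

open MvPolynomial IntermediateField.algebraAdjoinAdjoin in
theorem eq_zero_of_sum_mul_eq_zero {k K σ ι : Type*} [Field k] [IsAlgClosed k] [Field K]
    [Algebra k K] [Fintype ι] {s : σ → K} (B : IntermediateField k K)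
    (hs : AlgebraicIndependent B s) {a : ι → K}
    (ha : ∀ i, IsAlgebraic (IntermediateField.adjoin k (Set.range s)) (a i))
    (hli : LinearIndependent k a) (b : ι → B) (h : ∑ i, (b i : K) * a i = 0) : b = 0 := by
  refine eq_zero_of_sum_mul_eq_zero_of_common_denominators B hs (fun n f => ?_) ha hli b h
  obtain ⟨D, hD⟩ := IsLocalization.exist_integer_multiples_of_finite
    (nonZeroDivisors (Algebra.adjoin k (Set.range s))) f
  refine ⟨algebraMap _ _ (D : Algebra.adjoin k (Set.range s)),
    IsFractionRing.to_map_ne_zero_of_mem_nonZeroDivisors D.2, fun x => ?_⟩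
  obtain ⟨y, hy⟩ := hD x
  have hy2 : (y : K) ∈ (aeval s : MvPolynomial σ k →ₐ[k] K).range := by
    rw [← Algebra.adjoin_range_eq_range_aeval]; exact y.2
  obtain ⟨m, hm⟩ := hy2
  refine ⟨m, hm.trans ?_⟩
  rw [← Algebra.smul_def, ← hy]
  rfl

/-! ### The closure operator -/

instance : Algebra.IsAlgebraic ℚ Qbar :=
  ⟨fun x => (isAlgebraic_algebraMap_iff (A := ℂ) (algebraMap Qbar ℂ).injective).1
    (mem_algebraicClosure_iff.1 x.2)⟩

instance : IsAlgClosed Qbar :=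
  (IsAlgClosed.algebraicClosure_eq_bot_iff _ ℂ).1 (algebraicClosure.algebraicClosure_eq_bot ℚ ℂ)

theorem mem_algClosureAdjoin {S : Set ℂ} {x : ℂ} :
    x ∈ algClosureAdjoin S ↔ IsAlgebraic (IntermediateField.adjoin Qbar S) x := by
  rw [algClosureAdjoin, IntermediateField.mem_restrictScalars, mem_algebraicClosure_iff]

theorem coe_algClosureAdjoin (S : Set ℂ) :
    (algClosureAdjoin S : Set ℂ) = (AlgebraicIndependent.matroid Qbar ℂ).closure S := by
  ext x
  rw [AlgebraicIndependent.matroid_closure_eq, SetLike.mem_coe, mem_algClosureAdjoin,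
    SetLike.mem_coe, IntermediateField.isAlgebraic_adjoin_iff, Subalgebra.mem_algebraicClosure]

theorem algClosureAdjoin_mono {S T : Set ℂ} (h : S ⊆ T) :
    (algClosureAdjoin S : Set ℂ) ⊆ algClosureAdjoin T := by
  simp_rw [coe_algClosureAdjoin]
  exact Matroid.closure_subset_closure _ h

theorem algClosureAdjoin_subset_of_subset {S T : Set ℂ} (h : S ⊆ (algClosureAdjoin T : Set ℂ)) :
    (algClosureAdjoin S : Set ℂ) ⊆ algClosureAdjoin T := by
  rw [coe_algClosureAdjoin] at *
  rw [coe_algClosureAdjoin]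
  exact Matroid.closure_subset_closure_of_subset_closure h

/-- A finite subset of the closure of `S` lies in the closure of a finite subset of `S`. -/
theorem exists_finite_of_mem_algClosureAdjoin {S X : Set ℂ} (hX : X.Finite)
    (h : X ⊆ (algClosureAdjoin S : Set ℂ)) :
    ∃ T ⊆ S, T.Finite ∧ X ⊆ (algClosureAdjoin T : Set ℂ) := by
  induction X, hX using Set.Finite.induction_on with
  | empty => exact ⟨∅, by simp, Set.finite_empty, by simp⟩
  | @insert a X _ _ ih =>
    obtain ⟨T, hTS, hT, hXT⟩ := ih ((Set.subset_insert _ _).trans h)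
    have ha := h (Set.mem_insert a X)
    rw [coe_algClosureAdjoin] at ha
    obtain ⟨T', hT'S, hT', -, haT⟩ := Matroid.exists_mem_finite_closure_of_mem_closure ha
    rw [← coe_algClosureAdjoin] at haT
    exact ⟨T ∪ T', Set.union_subset hTS hT'S, hT.union hT', Set.insert_subset
      (algClosureAdjoin_mono Set.subset_union_right haT)
      (hXT.trans (algClosureAdjoin_mono Set.subset_union_left))⟩

theorem mem_algClosureAdjoin_of_isAlgebraic {S : Set ℂ} {x : ℂ}
    (hx : IsAlgebraic (algClosureAdjoin S) x) : x ∈ algClosureAdjoin S := by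
  rw [algClosureAdjoin, IntermediateField.mem_restrictScalars]
  have : x ∈ algebraicClosure (algebraicClosure (IntermediateField.adjoin Qbar S) ℂ) ℂ :=
    mem_algebraicClosure_iff.2 hx
  rw [algebraicClosure.algebraicClosure_eq_bot, IntermediateField.mem_bot] at this
  obtain ⟨y, rfl⟩ := this
  exact y.2

theorem mem_of_isAlgebraic_rat (F : IntermediateField Qbar ℂ) {x : ℂ} (hx : IsAlgebraic ℚ x) :
    x ∈ F :=
  F.algebraMap_mem ⟨x, mem_algebraicClosure_iff.2 hx⟩

theorem isAlgebraic_rat_of_mem_bot {x : ℂ} (hx : x ∈ (⊥ : IntermediateField Qbar ℂ)) :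
    IsAlgebraic ℚ x := by
  obtain ⟨y, rfl⟩ := IntermediateField.mem_bot.1 hx
  exact mem_algebraicClosure_iff.1 y.2

theorem coe_algClosureAdjoin_empty :
    (algClosureAdjoin ∅ : Set ℂ) = (⊥ : IntermediateField Qbar ℂ) := by
  apply le_antisymm
  · intro x hx
    rw [SetLike.mem_coe, mem_algClosureAdjoin, IntermediateField.adjoin_empty] at hx
    have h : IsAlgebraic Qbar x := by
      have : Algebra.IsAlgebraic Qbar (⊥ : IntermediateField Qbar ℂ) := inferInstance
      exact hx.restrictScalars Qbar
    have : x ∈ algebraicClosure (algebraicClosure ℚ ℂ) ℂ := mem_algebraicClosure_iff.2 h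
    rwa [algebraicClosure.algebraicClosure_eq_bot] at this
  · exact (bot_le : (⊥ : IntermediateField Qbar ℂ) ≤ _)

/-- An algebraically independent set in the closure of `S` is at most as large as `S`; this is the
rank inequality of the algebraic matroid. -/
theorem encard_le_of_algebraicIndependent {X : Set ℂ} (hX : AlgebraicIndepOn Qbar id X)
    {S : Set ℂ} (h : X ⊆ (algClosureAdjoin S : Set ℂ)) : X.encard ≤ S.encard := by
  rw [coe_algClosureAdjoin] at h
  rw [← AlgebraicIndependent.matroid_indep_iff] at hX
  refine (hX.encard_le_eRk_of_subset h).trans ?_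
  rw [Matroid.eRk_closure_eq]
  exact Matroid.eRk_le_encard _ _

theorem trdeg_adjoin_le {X : Set ℂ} {S : Finset ℂ}
    (h : X ⊆ (algClosureAdjoin (S : Set ℂ) : Set ℂ)) :
    Algebra.trdeg ℚ (IntermediateField.adjoin ℚ X) ≤ S.card := by
  obtain ⟨t, ht⟩ := exists_isTranscendenceBasis ℚ (IntermediateField.adjoin ℚ X)
  rw [← ht.cardinalMk_eq_trdeg]
  have h1 : AlgebraicIndependent ℚ (fun x : t => ((x : IntermediateField.adjoin ℚ X) : ℂ)) :=
    ht.1.map' (f := (IntermediateField.adjoin ℚ X).val) Subtype.val_injective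
  have h2 : AlgebraicIndependent Qbar (fun x : t => ((x : IntermediateField.adjoin ℚ X) : ℂ)) :=
    h1.extendScalars _
  have h3 := encard_le_of_algebraicIndependent (X := Set.range _) (S := (S : Set ℂ))
    h2.to_subtype_range ?_
  · rw [← Set.image_univ, Set.InjOn.encard_image h2.injective.injOn,
      Set.encard_univ, Set.encard_coe_eq_coe_finsetCard] at h3
    have hfin : Finite t := by
      by_contra hc
      rw [not_finite_iff_infinite] at hc
      rw [ENat.card_eq_top_of_infinite] at h3
      exact absurd h3 (by simp)
    have := Fintype.ofFinite t
    rw [ENat.card_eq_coe_fintype_card] at h3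
    rw [Cardinal.mk_fintype]
    exact_mod_cast h3
  · rintro _ ⟨x, rfl⟩
    have hle : IntermediateField.adjoin ℚ X ≤
        (algClosureAdjoin (S : Set ℂ)).restrictScalars ℚ := IntermediateField.adjoin_le_iff.2 h
    exact hle x.1.2

/-- A finite family is algebraically independent if it does not lie in the closure of a set with
fewer elements than the family has members. -/
theorem algebraicIndependent_of_card_le {ι : Type*} [Fintype ι] (v : ι → ℂ)
    (H : ∀ S : Finset ℂ, Set.range v ⊆ (algClosureAdjoin (S : Set ℂ) : Set ℂ) →
      Fintype.card ι ≤ S.card) : AlgebraicIndependent Qbar v := by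
  classical
  obtain ⟨I, hI⟩ := (AlgebraicIndependent.matroid Qbar ℂ).exists_isBasis (Set.range v)
  have hIfin : I.Finite := (Set.finite_range v).subset hI.subset
  have h1 := H hIfin.toFinset (by
    rw [coe_algClosureAdjoin, hIfin.coe_toFinset, hI.closure_eq_closure]
    exact Matroid.subset_closure _ _)
  have h2 : hIfin.toFinset ⊆ Finset.univ.image v := by
    intro x hx
    simpa using hI.subset (by simpa using hx)
  have h3 : (Finset.univ.image v).card ≤ Fintype.card ι := Finset.card_image_le
  have h4 := Finset.eq_of_subset_of_card_le h2 (h3.trans h1)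
  have hinj : Function.Injective v := by
    have : (Finset.univ.image v).card = (Finset.univ : Finset ι).card :=
      le_antisymm h3 (h4 ▸ h1)
    exact fun a b => Finset.card_image_iff.1 this (by simp) (by simp)
  have h5 : I = Set.range v := by
    have := congrArg (fun z : Finset ℂ => (z : Set ℂ)) h4
    simpa using this
  have h6 := AlgebraicIndependent.matroid_indep_iff.1 hI.indep
  rw [h5] at h6
  exact (algebraicIndependent_subtype_range hinj).1 h6

/-- Two fields are linearly disjoint over `Q̄` if finite subsets of them are always algebraic over
fields `Q̄(s)` and `Q̄(t)` with `s` and `t` jointly algebraically independent. -/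
theorem linearDisjoint_of_exists_algebraicIndependent {A B : IntermediateField Qbar ℂ}
    (h : ∀ X Z : Set ℂ, X.Finite → Z.Finite → X ⊆ A → Z ⊆ B →
      ∃ (σ τ : Type) (s : σ → ℂ) (t : τ → ℂ), AlgebraicIndependent Qbar (Sum.elim s t) ∧
        X ⊆ (algClosureAdjoin (Set.range s) : Set ℂ) ∧
        Z ⊆ (algClosureAdjoin (Set.range t) : Set ℂ)) : A.LinearDisjoint B := by
  let e := Module.Basis.ofVectorSpace Qbar A
  refine IntermediateField.LinearDisjoint.of_basis_left e ?_
  rw [linearIndependent_iff']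
  intro I g hg i hi
  obtain ⟨σ, τ, s, t, hst, hX, hZ⟩ := h (Set.range fun i : I => (e i : ℂ))
    (Set.range fun i : I => (g i : ℂ)) (Set.finite_range _) (Set.finite_range _)
    (by rintro _ ⟨i, rfl⟩; exact (e i).2) (by rintro _ ⟨i, rfl⟩; exact (g i).2)
  have hs : AlgebraicIndependent (algClosureAdjoin (Set.range t)) s := by
    have h1 := (AlgebraicIndependent.sumElim_iff.1 hst).2
    rw [← IntermediateField.algebraicIndependent_adjoin_iff] at h1
    exact h1.extendScalars (algebraicClosure (IntermediateField.adjoin Qbar (Set.range t)) ℂ)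
  have hli : LinearIndependent Qbar (fun i : I => (e i : ℂ)) :=
    (e.linearIndependent.map' A.val.toLinearMap
      (LinearMap.ker_eq_bot.2 Subtype.val_injective)).comp _ Subtype.val_injective
  have h0 := eq_zero_of_sum_mul_eq_zero (algClosureAdjoin (Set.range t)) hs
    (fun i : I => mem_algClosureAdjoin.1 (hX ⟨i, rfl⟩)) hli (fun i => ⟨g i, hZ ⟨i, rfl⟩⟩) (by
      rw [← hg, ← Finset.sum_coe_sort I]
      rfl)
  have := congrArg Subtype.val (congrFun h0 ⟨i, hi⟩)
  exact Subtype.ext this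

/-! ### Elliptic functions -/

theorem tendsto_affine_nhdsNE {α : ℂ} (hα : α ≠ 0) (w z : ℂ) :
    Tendsto (fun x => α * x + w) (𝓝[≠] z) (𝓝[≠] (α * z + w)) := by
  refine tendsto_nhdsWithin_of_tendsto_nhds_of_eventually_within _ ?_ ?_
  · exact (Continuous.tendsto (by fun_prop) z).mono_left nhdsWithin_le_nhds
  · filter_upwards [self_mem_nhdsWithin] with x hx h
    exact hx (mul_left_cancel₀ hα (add_right_cancel h))

namespace PeriodPair

variable (L : PeriodPair)

/-- Liouville's theorem for elliptic functions: a periodic function with removable singularities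
is constant away from these singularities. -/
theorem exists_eq_const_of_periodic {h : ℂ → ℂ} (hper : ∀ z, ∀ l ∈ L.lattice, h (z + l) = h z)
    (hg : ∀ s, ∃ g, AnalyticAt ℂ g s ∧ h =ᶠ[𝓝[≠] s] g) :
    ∃ c, ∀ z, ContinuousAt h z → h z = c := by
  -- the continuous extension of `h`
  let H : ℂ → ℂ := fun z => limUnder (𝓝[≠] z) h
  have hH {s : ℂ} {g : ℂ → ℂ} (hgs : ContinuousAt g s) (hh : h =ᶠ[𝓝[≠] s] g) : H s = g s :=
    ((hgs.tendsto.mono_left nhdsWithin_le_nhds).congr' hh.symm).limUnder_eq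
  have hHan (s : ℂ) : AnalyticAt ℂ H s := by
    obtain ⟨g, hgs, hh⟩ := hg s
    refine hgs.congr ?_
    have h1 := eventually_eventually_nhdsWithin.2 hh
    have h2 : ∀ᶠ x in 𝓝 s, AnalyticAt ℂ g x := hgs.eventually_analyticAt
    rw [eventually_nhdsWithin_iff] at h1
    filter_upwards [h1, h2] with x hx1 hx2
    by_cases hxs : x = s
    · rw [hxs]; exact (hH hgs.continuousAt hh).symm
    · refine (hH hx2.continuousAt ?_).symm
      have h3 := hx1 hxs
      rw [nhdsWithin_eq_nhds.2 (isOpen_compl_singleton.mem_nhds hxs)] at h3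
      exact h3.filter_mono nhdsWithin_le_nhds
  have hHper : ∀ z w, w ∈ L.lattice → H (z + w) = H z := by
    intro z w hw
    obtain ⟨g, hgs, hh⟩ := hg z
    rw [hH hgs.continuousAt hh]
    have hc : ContinuousAt (fun x => g (x - w)) (z + w) :=
      ContinuousAt.comp_of_eq hgs.continuousAt (by fun_prop) (by ring)
    rw [hH hc, add_sub_cancel_right]
    have := tendsto_affine_nhdsNE one_ne_zero (-w) (z + w)
    simp only [one_mul, add_neg_cancel_right] at this
    filter_upwards [this.eventually hh] with x hx
    rw [← sub_eq_add_neg] at hx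
    rw [← hx, ← hper (x - w) w hw, sub_add_cancel]
  have hdiff : Differentiable ℂ H := fun s => (hHan s).differentiableAt
  have hb := (IsZLattice.isCompact_range_of_periodic L.lattice H hdiff.continuous hHper).isBounded
  refine ⟨H 0, fun z hz => ?_⟩
  rw [← hH hz EventuallyEq.rfl]
  exact hdiff.apply_eq_apply_of_bounded hb z 0

theorem eventually_notMem_lattice (s : ℂ) : ∀ᶠ z in 𝓝[≠] s, z ∉ L.lattice := by
  filter_upwards [self_mem_nhdsWithin, mem_nhdsWithin_of_mem_nhds
    (L.compl_lattice_sdiff_singleton_mem_nhds s)] with z hz hz'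
  by_contra h
  exact hz' ⟨h, hz⟩

/-- Elliptic functions with no poles outside `Λ` and poles of order at most `n` on `Λ` are
linearly dependent as soon as there are `n + 2` of them: `n` conditions remove the pole at `0`,
and one more makes the resulting constant vanish. -/
theorem exists_linear_relation {ι : Type*} [Fintype ι] (n : ℕ) (hn : n + 2 ≤ Fintype.card ι)
    {h k : ι → ℂ → ℂ} (hper : ∀ i z, ∀ l ∈ L.lattice, h i (z + l) = h i z)
    (hd : ∀ i, ∀ z ∉ L.lattice, AnalyticAt ℂ (h i) z) (hk : ∀ i, AnalyticAt ℂ (k i) 0)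
    (hkh : ∀ i, ∀ᶠ z in 𝓝[≠] 0, k i z = z ^ n * h i z) :
    ∃ c : ι → ℂ, c ≠ 0 ∧ ∀ z ∉ L.lattice, ∑ i, c i * h i z = 0 := by
  -- `n` rows for the Taylor coefficients of `zⁿ ∑ cᵢ hᵢ` at `0`, one for the value at `ω₁ / 2`
  let M : Matrix (Fin n ⊕ Unit) ι ℂ := Matrix.of fun j i =>
    Sum.elim (fun j : Fin n => iteratedDeriv j (k i) 0) (fun _ => h i (L.ω₁ / 2)) j
  have hker : M.mulVecLin.ker ≠ ⊥ := by
    apply LinearMap.ker_ne_bot_of_finrank_lt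
    simp only [Module.finrank_fintype_fun_eq_card, Fintype.card_sum, Fintype.card_fin,
      Fintype.card_unit]
    omega
  obtain ⟨c, hc, hc0⟩ := (Submodule.ne_bot_iff _).1 hker
  refine ⟨c, hc0, ?_⟩
  have hc' := LinearMap.mem_ker.1 hc
  have hK : AnalyticAt ℂ (fun z => ∑ i, c i * k i z) 0 :=
    Finset.analyticAt_fun_sum _ fun i _ => analyticAt_const.mul (hk i)
  have hord : (n : ℕ∞) ≤ analyticOrderAt (fun z => ∑ i, c i * k i z) 0 := by
    rw [natCast_le_analyticOrderAt_iff_iteratedDeriv_eq_zero hK]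
    intro j hj
    rw [iteratedDeriv_fun_sum (f := fun i z => c i * k i z)
      fun i _ => (analyticAt_const.mul (hk i)).contDiffAt]
    have := congrFun hc' (Sum.inl ⟨j, hj⟩)
    simp only [M, Matrix.mulVecLin_apply, Matrix.mulVec, dotProduct, Matrix.of_apply,
      Sum.elim_inl, Pi.zero_apply] at this
    refine Eq.trans (Finset.sum_congr rfl fun i _ => ?_) this
    rw [iteratedDeriv_const_mul _ (hk i).contDiffAt, mul_comm]
  obtain ⟨g, hg, hgK⟩ := (natCast_le_analyticOrderAt hK).1 hord
  have hsum (z : ℂ) (hz : z ∉ L.lattice) : AnalyticAt ℂ (fun z => ∑ i, c i * h i z) z :=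
    Finset.analyticAt_fun_sum _ fun i _ => analyticAt_const.mul (hd i z hz)
  have hz1 : L.ω₁ / 2 ∉ L.lattice := L.ω₁_div_two_notMem_lattice
  have hperS : ∀ z, ∀ l ∈ L.lattice, ∑ i, c i * h i (z + l) = ∑ i, c i * h i z :=
    fun z l hl => by simp_rw [fun i => hper i z l hl]
  have hg0 : (fun z => ∑ i, c i * h i z) =ᶠ[𝓝[≠] 0] g := by
    filter_upwards [eventually_all.2 hkh, self_mem_nhdsWithin,
      mem_nhdsWithin_of_mem_nhds hgK] with z hz hz0 hzK
    have hzn : z ^ n ≠ 0 := pow_ne_zero _ hz0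
    apply mul_left_cancel₀ hzn
    simp only [sub_zero, smul_eq_mul] at hzK
    rw [← hzK, Finset.mul_sum]
    exact Finset.sum_congr rfl fun i _ => by rw [hz i]; ring
  obtain ⟨C, hC⟩ := L.exists_eq_const_of_periodic hperS (fun s => by
    by_cases hs : s ∈ L.lattice
    · refine ⟨fun z => g (z - s), ?_, ?_⟩
      · exact AnalyticAt.comp_of_eq hg (by fun_prop) (sub_self s)
      · have := tendsto_affine_nhdsNE one_ne_zero (-s) s
        simp only [one_mul, add_neg_cancel] at this
        filter_upwards [this.eventually hg0] with x hx
        rw [sub_eq_add_neg, ← hx, hperS x (-s) (neg_mem hs)]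
    · exact ⟨_, hsum s hs, EventuallyEq.rfl⟩)
  intro z hz
  rw [hC z (hsum z hz).continuousAt, ← hC _ (hsum _ hz1).continuousAt]
  have := congrFun hc' (Sum.inr ())
  simp only [M, Matrix.mulVecLin_apply, Matrix.mulVec, dotProduct, Matrix.of_apply,
      Sum.elim_inr, Pi.zero_apply] at this
  rw [← this]
  exact Finset.sum_congr rfl fun i _ => mul_comm _ _

/-! ### Local behaviour of `℘` -/

theorem weierstrassP_add {z l : ℂ} (hl : l ∈ L.lattice) :
    L.weierstrassP (z + l) = L.weierstrassP z := L.weierstrassP_add_coe z ⟨l, hl⟩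

/-- Near a lattice point, `(z - l)² ℘(z)` extends to an analytic function with value `1`. -/
theorem exists_analyticAt_sq_mul_weierstrassP {l : ℂ} (hl : l ∈ L.lattice) :
    ∃ e : ℂ → ℂ, AnalyticAt ℂ e l ∧ e l = 1 ∧
      ∀ z ≠ l, e z = (z - l) ^ 2 * L.weierstrassP z := by
  refine ⟨fun z => (z - l) ^ 2 * L.weierstrassPExcept l z + 1 - (z - l) ^ 2 / l ^ 2,
    ?_, by simp, fun z hz => ?_⟩
  · have h1 := L.analyticAt_weierstrassPExcept l
    have h2 : AnalyticAt ℂ (fun z : ℂ => (z - l) ^ 2 / l ^ 2) l := by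
      simp_rw [div_eq_mul_inv]; fun_prop
    fun_prop
  · exact (L.ite_eq_one_sub_sq_mul_weierstrassP l hl z).symm.trans (if_neg hz)

theorem tendsto_weierstrassP_cobounded {l : ℂ} (hl : l ∈ L.lattice) :
    Tendsto L.weierstrassP (𝓝[≠] l) (Bornology.cobounded ℂ) :=
  tendsto_cobounded_of_meromorphicOrderAt_neg (by rw [L.order_weierstrassP l hl]; decide)

theorem eventually_weierstrassP_ne {l : ℂ} (hl : l ∈ L.lattice) (c : ℂ) :
    ∀ᶠ z in 𝓝[≠] l, L.weierstrassP z ≠ c :=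
  (L.tendsto_weierstrassP_cobounded hl).eventually_ne_cobounded c

theorem countable_lattice : (L.lattice : Set ℂ).Countable := by
  have : Countable L.lattice := L.latticeEquivProd.toEquiv.countable_iff.2 inferInstance
  exact Set.to_countable _

theorem isPreconnected_compl_of_countable {s : Set ℂ} (hs : s.Countable) : IsPreconnected sᶜ :=
  (hs.isPathConnected_compl_of_one_lt_rank (by simp)).isConnected.isPreconnected

theorem not_eventually_weierstrassP_eq {z : ℂ} (hz : z ∉ L.lattice) (c : ℂ) :
    ¬ ∀ᶠ x in 𝓝 z, L.weierstrassP x = c := by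
  intro h
  have h1 := L.analyticOnNhd_weierstrassP.eqOn_of_preconnected_of_eventuallyEq
    (g := fun _ => c) analyticOnNhd_const
    (isPreconnected_compl_of_countable L.countable_lattice) (z₀ := z) hz h
  obtain ⟨x, hx1, hx2⟩ := ((L.eventually_notMem_lattice 0).and
    (L.eventually_weierstrassP_ne L.lattice.zero_mem c)).exists
  exact hx2 (h1 hx1)

theorem hasDerivAt_weierstrassP {z : ℂ} (hz : z ∉ L.lattice) :
    HasDerivAt L.weierstrassP (L.derivWeierstrassP z) z := by
  rw [← L.deriv_weierstrassP]
  exact (L.analyticOnNhd_weierstrassP z hz).differentiableAt.hasDerivAt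

/-- The differential equation `℘'' = 6 ℘² - g₂ / 2`, from the first order equation. -/
theorem deriv_derivWeierstrassP {z : ℂ} (hz : z ∉ L.lattice) :
    deriv L.derivWeierstrassP z = 6 * L.weierstrassP z ^ 2 - L.g₂ / 2 := by
  have hopen : IsOpen (L.lattice : Set ℂ)ᶜ := L.isClosed_lattice.isOpen_compl
  have hconn := isPreconnected_compl_of_countable L.countable_lattice
  have hP := L.analyticOnNhd_weierstrassP
  have hP' := L.analyticOnNhd_derivWeierstrassP
  have key : ∀ x ∈ (L.lattice : Set ℂ)ᶜ, L.derivWeierstrassP x *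
      (deriv L.derivWeierstrassP x - (6 * L.weierstrassP x ^ 2 - L.g₂ / 2)) = 0 := by
    intro x hx
    have h1 : (fun x => L.derivWeierstrassP x ^ 2) =ᶠ[𝓝 x]
        fun x => 4 * L.weierstrassP x ^ 3 - L.g₂ * L.weierstrassP x - L.g₃ := by
      filter_upwards [hopen.mem_nhds hx] with y hy using L.derivWeierstrassP_sq y hy
    have h2 := h1.deriv_eq
    have h3 := ((hP' x hx).differentiableAt.hasDerivAt.fun_pow 2).deriv
    have h4 := (((((L.hasDerivAt_weierstrassP hx).fun_pow 3).const_mul 4).sub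
      ((L.hasDerivAt_weierstrassP hx).const_mul L.g₂)).sub_const L.g₃).deriv
    have h5 := h3.symm.trans (h2.trans h4)
    norm_num at h5
    linear_combination h5 / 2
  have han : AnalyticOnNhd ℂ (fun x => deriv L.derivWeierstrassP x -
      (6 * L.weierstrassP x ^ 2 - L.g₂ / 2)) (L.lattice : Set ℂ)ᶜ := fun x hx => by
    have h1 := (hP' x hx).deriv
    have h2 := hP x hx
    fun_prop
  rcases hP'.eq_zero_or_eq_zero_of_mul_eq_zero han key hconn with h | h
  · exfalso
    refine L.not_eventually_weierstrassP_eq hz (L.weierstrassP z) ?_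
    filter_upwards [hopen.mem_nhds hz] with y hy
    exact hopen.is_const_of_deriv_eq_zero hconn L.differentiableOn_weierstrassP
      (fun x hx => by rw [L.deriv_weierstrassP]; exact h x hx) hy hz
  · exact sub_eq_zero.1 (h z hz)

theorem hasDerivAt_derivWeierstrassP {z : ℂ} (hz : z ∉ L.lattice) :
    HasDerivAt L.derivWeierstrassP (6 * L.weierstrassP z ^ 2 - L.g₂ / 2) z := by
  rw [← L.deriv_derivWeierstrassP hz]
  exact (L.analyticOnNhd_derivWeierstrassP z hz).differentiableAt.hasDerivAt

/-! ### Algebraic dependence of `℘(z)` and `℘(α z + w)` -/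

theorem finite_lattice_inter_closedBall (r : ℝ) :
    {z : ℂ | z ∈ L.lattice ∧ ‖z‖ ≤ r}.Finite := by
  have : DiscreteTopology (L.lattice : Set ℂ) := inferInstanceAs (DiscreteTopology L.lattice)
  have := Metric.finite_isBounded_inter_isClosed (K := Metric.closedBall 0 r)
    ⟨this⟩ Metric.isBounded_closedBall L.isClosed_lattice
  refine this.subset fun z hz => ⟨by simpa using hz.2, hz.1⟩

/-- Finitely many points represent the solutions of `α z + w ∈ Λ` modulo `Λ`. -/
theorem exists_finset_representatives {α w : ℂ} (hα : α ≠ 0)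
    (hαL : ∀ l ∈ L.lattice, α * l ∈ L.lattice) :
    ∃ S : Finset ℂ, (∀ s ∈ S, α * s + w ∈ L.lattice) ∧
      ∀ z, α * z + w ∈ L.lattice → ∃ s ∈ S, z - s ∈ L.lattice := by
  let R : ℝ := ∑ i, ‖L.basis i‖
  have hfin : {z : ℂ | α * z + w ∈ L.lattice ∧ ‖z‖ ≤ R}.Finite := by
    refine Set.Finite.of_finite_image
      ((L.finite_lattice_inter_closedBall (‖α‖ * R + ‖w‖)).subset ?_) (f := fun z => α * z + w) ?_
    · rintro _ ⟨z, ⟨hz1, hz2⟩, rfl⟩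
      refine ⟨hz1, (norm_add_le _ _).trans ?_⟩
      rw [norm_mul]
      gcongr
    · intro x _ y _ hxy
      exact mul_left_cancel₀ hα (add_right_cancel hxy)
  refine ⟨hfin.toFinset, fun s hs => ((hfin.mem_toFinset).1 hs).1, fun z hz => ?_⟩
  have hmem : z - ZSpan.fract L.basis z ∈ L.lattice := by
    rw [ZSpan.fract_apply, sub_sub_cancel, L.lattice_eq_span_range_basis]
    exact (ZSpan.floor L.basis z).2
  refine ⟨ZSpan.fract L.basis z, hfin.mem_toFinset.2 ⟨?_, ZSpan.norm_fract_le L.basis z⟩, hmem⟩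
  have := sub_mem hz (hαL _ hmem)
  convert this using 1
  ring

theorem analyticAt_weierstrassP_affine {α w z : ℂ} (hz : α * z + w ∉ L.lattice) :
    AnalyticAt ℂ (fun z => L.weierstrassP (α * z + w)) z :=
  AnalyticAt.comp_of_eq (L.analyticOnNhd_weierstrassP _ hz) (by fun_prop) rfl

/-- The functions `℘(z)` and `℘(α z + w)` are algebraically dependent. The factor `Q` below, a
polynomial in `℘`, cancels the poles of `℘(α z + w)`; the monomials times a power of `Q` have
poles only on `Λ`, and for large `N` there are more of them than the order of these poles. -/
theorem exists_relation {α w : ℂ} (hα : α ≠ 0) (hαL : ∀ l ∈ L.lattice, α * l ∈ L.lattice)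
    (hw : w ∉ L.lattice) :
    ∃ (N : ℕ) (c : Fin (N + 1) × Fin 3 → ℂ), c ≠ 0 ∧ ∀ᶠ z in 𝓝[≠] 0,
      ∑ x, c x * (L.weierstrassP z ^ (x.1 : ℕ) * L.weierstrassP (α * z + w) ^ (x.2 : ℕ)) = 0 := by
  classical
  obtain ⟨S, hS, hSz⟩ := L.exists_finset_representatives (w := w) hα hαL
  let Q : ℂ → ℂ := fun z => ∏ s ∈ S, (L.weierstrassP z - L.weierstrassP s) ^ 3
  let f : ℂ → ℂ := fun z => L.weierstrassP (α * z + w)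
  have hQ (z : ℂ) (hz : z ∉ L.lattice) : AnalyticAt ℂ Q z :=
    Finset.analyticAt_fun_prod _ fun s _ => by
      have := L.analyticOnNhd_weierstrassP z hz
      fun_prop
  have hQper (z l : ℂ) (hl : l ∈ L.lattice) : Q (z + l) = Q z := by
    simp only [Q, L.weierstrassP_add hl]
  have hfper (z l : ℂ) (hl : l ∈ L.lattice) : f (z + l) = f z := by
    simp only [f]
    rw [← L.weierstrassP_add (z := α * z + w) (hαL l hl)]
    congr 1
    ring
  -- the cubes in `Q` make `Q f` not just bounded but zero at the poles of `f`
  have hQf (z : ℂ) (hz : z ∉ L.lattice) : AnalyticAt ℂ (fun z => Q z * f z) z := by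
    by_cases hzp : α * z + w ∈ L.lattice
    · obtain ⟨s, hs, hzs⟩ := hSz z hzp
      have hPs : L.weierstrassP z = L.weierstrassP s := by
        rw [← L.weierstrassP_add (z := s) hzs, add_sub_cancel]
      have hP := L.analyticOnNhd_weierstrassP z hz
      have hP0 : AnalyticAt ℂ (fun x => L.weierstrassP x - L.weierstrassP s) z := by fun_prop
      obtain ⟨a, ha, haP⟩ := (natCast_le_analyticOrderAt hP0 (n := 1)).1 (by
        rw [natCast_le_analyticOrderAt_iff_iteratedDeriv_eq_zero hP0]
        intro i hi
        obtain rfl : i = 0 := by omega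
        simp [hPs])
      obtain ⟨e, he, -, hef⟩ := L.exists_analyticAt_sq_mul_weierstrassP hzp
      have hprod : AnalyticAt ℂ
          (fun x => ∏ t ∈ S.erase s, (L.weierstrassP x - L.weierstrassP t) ^ 3) z :=
        Finset.analyticAt_fun_prod _ fun s _ => by fun_prop
      have he' : AnalyticAt ℂ (fun x => e (α * x + w)) z :=
        AnalyticAt.comp_of_eq he (by fun_prop) rfl
      have hG : AnalyticAt ℂ (fun x => (x - z) * a x ^ 3 * (e (α * x + w) / α ^ 2) *
          ∏ t ∈ S.erase s, (L.weierstrassP x - L.weierstrassP t) ^ 3) z := by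
        simp_rw [div_eq_mul_inv]
        fun_prop
      refine hG.congr ?_
      filter_upwards [haP] with x hx
      simp only [Q, f]
      rw [← Finset.mul_prod_erase S _ hs, hx]
      by_cases hxz : x = z
      · simp [hxz]
      · have hne : α * x + w ≠ α * z + w := fun h =>
          hxz (mul_left_cancel₀ hα (add_right_cancel h))
        rw [hef _ hne]
        have : α * x + w - (α * z + w) = α * (x - z) := by ring
        rw [this, smul_eq_mul]
        field
    · have h1 := hQ z hz
      have h2 : AnalyticAt ℂ f z := L.analyticAt_weierstrassP_affine hzp
      fun_prop
  obtain ⟨e, he, -, heP⟩ := L.exists_analyticAt_sq_mul_weierstrassP L.lattice.zero_mem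
  let q : ℂ → ℂ := fun z => ∏ s ∈ S, (e z - L.weierstrassP s * z ^ 2) ^ 3
  have hq : AnalyticAt ℂ q 0 := Finset.analyticAt_fun_prod _ fun s _ => by fun_prop
  have hqQ (z : ℂ) (hz : z ≠ 0) : q z = z ^ (6 * S.card) * Q z := by
    simp only [q, Q]
    rw [pow_mul, ← Finset.prod_const, ← Finset.prod_mul_distrib]
    refine Finset.prod_congr rfl fun s _ => ?_
    rw [heP z hz]
    ring
  have hf0 : AnalyticAt ℂ f 0 := L.analyticAt_weierstrassP_affine (by simpa using hw)
  -- `Q ^ 2` times a monomial has a pole of order at most `2 M + 12 #S` at `0`, and there are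
  -- `3 (M + 1)` monomials
  let M := 12 * S.card
  obtain ⟨c, hc0, hc⟩ := L.exists_linear_relation (ι := Fin (M + 1) × Fin 3)
    (2 * M + 12 * S.card) (by simp [M]; omega)
    (h := fun x z => L.weierstrassP z ^ (x.1 : ℕ) * Q z ^ (2 - (x.2 : ℕ)) *
      (Q z * f z) ^ (x.2 : ℕ))
    (k := fun x z => e z ^ (x.1 : ℕ) * z ^ (2 * (M - x.1)) * q z ^ (2 - (x.2 : ℕ)) *
      (q z * f z) ^ (x.2 : ℕ))
    (fun x z l hl => by simp only [hQper z l hl, hfper z l hl, L.weierstrassP_add hl])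
    (fun x z hz => by
      have h1 := hQ z hz
      have h2 := hQf z hz
      have h3 := L.analyticOnNhd_weierstrassP z hz
      fun_prop)
    (fun x => by fun_prop)
    (fun x => by
      filter_upwards [self_mem_nhdsWithin] with z hz
      have hx1 : (x.1 : ℕ) ≤ M := Nat.lt_succ_iff.1 x.1.2
      have hx2 : (x.2 : ℕ) ≤ 2 := Nat.lt_succ_iff.1 x.2.2
      rw [hqQ z hz, heP z hz, sub_zero]
      have e1 : 2 * M + 12 * S.card =
        2 * x.1 + 2 * (M - x.1) + 6 * S.card * (2 - x.2) + 6 * S.card * x.2 := by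
        rw [add_assoc, add_assoc, ← mul_add, Nat.sub_add_cancel hx2, ← add_assoc, ← mul_add,
          Nat.add_sub_cancel' hx1]
        ring
      rw [e1]
      simp only [pow_add, pow_mul, mul_pow]
      ring)
  refine ⟨M, c, hc0, ?_⟩
  have hQ0 : ∀ᶠ z in 𝓝[≠] (0 : ℂ), Q z ≠ 0 := by
    have := (Finset.eventually_all S).2 fun s _ =>
      L.eventually_weierstrassP_ne L.lattice.zero_mem (L.weierstrassP s)
    filter_upwards [this] with z hz
    exact Finset.prod_ne_zero_iff.2 fun s hs => pow_ne_zero _ (sub_ne_zero.2 (hz s hs))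
  filter_upwards [hQ0, L.eventually_notMem_lattice 0] with z hz1 hz2
  apply (mul_eq_zero.1 (Eq.trans ?_ (hc z hz2))).resolve_left (pow_ne_zero 2 hz1)
  rw [Finset.mul_sum]
  refine Finset.sum_congr rfl fun x _ => ?_
  have hx2 : (x.2 : ℕ) ≤ 2 := Nat.lt_succ_iff.1 x.2.2
  have : Q z ^ 2 = Q z ^ (2 - (x.2 : ℕ)) * Q z ^ (x.2 : ℕ) := by
    rw [← pow_add, Nat.sub_add_cancel hx2]
  rw [this, mul_pow (Q z)]
  ring

end PeriodPair

section

open Polynomial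
open scoped Polynomial.Bivariate

/-! ### Analytic germs with derivatives in a subfield -/

/-- The germ of `h` at `0` is analytic and its derivatives at `0` of order at most `n` lie in the
field `F`. -/
def HasDerivsIn (F : IntermediateField Qbar ℂ) (n : ℕ) (h : ℂ → ℂ) : Prop :=
  AnalyticAt ℂ h 0 ∧ ∀ k ≤ n, iteratedDeriv k h 0 ∈ F

namespace HasDerivsIn

variable {F : IntermediateField Qbar ℂ} {n : ℕ} {h h' : ℂ → ℂ}

theorem const {c : ℂ} (hc : c ∈ F) : HasDerivsIn F n fun _ => c :=
  ⟨analyticAt_const, fun k _ => by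
    rw [iteratedDeriv_const]
    split_ifs
    exacts [hc, F.zero_mem]⟩

theorem add (hh : HasDerivsIn F n h) (hh' : HasDerivsIn F n h') :
    HasDerivsIn F n fun z => h z + h' z :=
  ⟨hh.1.fun_add hh'.1, fun k hk => by
    rw [iteratedDeriv_fun_add hh.1.contDiffAt hh'.1.contDiffAt]
    exact F.add_mem (hh.2 k hk) (hh'.2 k hk)⟩

theorem mul (hh : HasDerivsIn F n h) (hh' : HasDerivsIn F n h') :
    HasDerivsIn F n fun z => h z * h' z :=
  ⟨hh.1.fun_mul hh'.1, fun k hk => by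
    rw [iteratedDeriv_fun_mul hh.1.contDiffAt hh'.1.contDiffAt]
    refine sum_mem fun i hi => F.mul_mem (F.mul_mem (natCast_mem F _) (hh.2 i ?_)) (hh'.2 _ ?_)
    · exact (Nat.lt_succ_iff.1 (Finset.mem_range.1 hi)).trans hk
    · exact (Nat.sub_le _ _).trans hk⟩

theorem pow (hh : HasDerivsIn F n h) (m : ℕ) : HasDerivsIn F n fun z => h z ^ m := by
  induction m with
  | zero => simpa using const F.one_mem
  | succ m ih => simpa [pow_succ] using ih.mul hh

/-- A solution of `y'' = a + b y + c y² + d y³` with coefficients and initial values in `F` has all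
its derivatives in `F`. -/
theorem of_ode {y : ℂ → ℂ} {a b c d : ℂ} (hy : AnalyticAt ℂ y 0) (h0 : y 0 ∈ F)
    (h1 : deriv y 0 ∈ F) (ha : a ∈ F) (hb : b ∈ F) (hc : c ∈ F) (hd : d ∈ F)
    (hode : ∀ᶠ z in 𝓝 0, deriv (deriv y) z = a + b * y z + c * y z ^ 2 + d * y z ^ 3) (n : ℕ) :
    HasDerivsIn F n y := by
  induction n with
  | zero => exact ⟨hy, fun k hk => by
      obtain rfl : k = 0 := by omega
      simpa using h0⟩
  | succ n ih =>
    refine ⟨hy, fun k hk => ?_⟩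
    match k with
    | 0 => simpa using h0
    | 1 => simpa using h1
    | k + 2 =>
      rw [iteratedDeriv_succ', iteratedDeriv_succ', Filter.EventuallyEq.iteratedDeriv_eq k hode]
      exact ((((const ha).add ((const hb).mul ih)).add ((const hc).mul (ih.pow 2))).add
        ((const hd).mul (ih.pow 3))).2 k (by omega)

/-- A linear relation with complex coefficients between germs with derivatives in `F` gives
one with coefficients in `F`. -/
theorem exists_relation {ι : Type*} [Fintype ι] {p : ι → ℂ → ℂ}
    (hp : ∀ i n, HasDerivsIn F n (p i)) {c : ι → ℂ} (hc : c ≠ 0)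
    (h : ∀ᶠ z in 𝓝 0, ∑ i, c i * p i z = 0) :
    ∃ c' : ι → F, c' ≠ 0 ∧ ∀ᶠ z in 𝓝 0, ∑ i, (c' i : ℂ) * p i z = 0 := by
  obtain ⟨i₀, hi₀⟩ := Function.ne_iff.1 hc
  obtain ⟨φ, hφ⟩ : ∃ φ : Module.Dual F ℂ, φ (c i₀) ≠ 0 := by
    by_contra! hcon
    exact hi₀ ((Module.forall_dual_apply_eq_zero_iff F _).1 hcon)
  -- apply an `F`-linear form on `ℂ` to the coefficients
  refine ⟨fun i => φ (c i), fun h0 => hφ (congrFun h0 i₀), ?_⟩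
  have hsum (c : ι → ℂ) : AnalyticAt ℂ (fun z => ∑ i, c i * p i z) 0 :=
    Finset.analyticAt_fun_sum _ fun i _ => analyticAt_const.mul (hp i 0).1
  have hder (c : ι → ℂ) (n : ℕ) : iteratedDeriv n (fun z => ∑ i, c i * p i z) 0 =
      ∑ i, c i * iteratedDeriv n (p i) 0 := by
    rw [iteratedDeriv_fun_sum (f := fun i z => c i * p i z)
      fun i _ => (analyticAt_const.mul (hp i 0).1).contDiffAt]
    exact Finset.sum_congr rfl fun i _ => iteratedDeriv_const_mul _ (hp i 0).1.contDiffAt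
  rw [← analyticOrderAt_eq_top, ENat.eq_top_iff_forall_ge]
  intro n
  rw [natCast_le_analyticOrderAt_iff_iteratedDeriv_eq_zero (hsum _)]
  intro k _
  have h1 : ∑ i, c i * iteratedDeriv k (p i) 0 = 0 := by
    rw [← hder, Filter.EventuallyEq.iteratedDeriv_eq (g := fun _ => 0) k h]
    simp
  rw [hder]
  have h2 := congrArg (fun z => ((φ z : F) : ℂ)) h1
  simp only [map_sum, map_zero, AddSubmonoidClass.coe_finsetSum] at h2
  refine Eq.trans (Finset.sum_congr rfl fun i _ => ?_) h2
  have h3 : c i * iteratedDeriv k (p i) 0 =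
      (⟨iteratedDeriv k (p i) 0, (hp i k).2 k le_rfl⟩ : F) • c i := by
    rw [Algebra.smul_def, mul_comm]; rfl
  rw [h3, map_smul, smul_eq_mul, mul_comm]
  rfl

end HasDerivsIn

namespace PeriodPair

variable (L : PeriodPair)

/-- The germ `1 / ℘` at `0` and its differential equation. -/
theorem exists_inv_weierstrassP : ∃ u : ℂ → ℂ, AnalyticAt ℂ u 0 ∧ u 0 = 0 ∧ deriv u 0 = 0 ∧
    (∀ᶠ z in 𝓝[≠] 0, u z = (L.weierstrassP z)⁻¹) ∧
    ∀ᶠ z in 𝓝 0, deriv (deriv u) z =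
      2 + 0 * u z + (-3 / 2 * L.g₂) * u z ^ 2 + (-2 * L.g₃) * u z ^ 3 := by
  obtain ⟨e, he, he0, heP⟩ := L.exists_analyticAt_sq_mul_weierstrassP L.lattice.zero_mem
  have he0' : e 0 ≠ 0 := by simp [he0]
  have hu : AnalyticAt ℂ (fun z => z ^ 2 / e z) 0 := (analyticAt_id.pow 2).div he he0'
  have huP : ∀ᶠ z in 𝓝[≠] 0, z ^ 2 / e z = (L.weierstrassP z)⁻¹ := by
    filter_upwards [self_mem_nhdsWithin] with z hz
    rw [heP z hz, sub_zero, div_mul_cancel_left₀ (pow_ne_zero 2 hz)]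
  refine ⟨fun z => z ^ 2 / e z, hu, by simp, ?_, huP, ?_⟩
  · have := ((hasDerivAt_pow 2 (0 : ℂ)).div he.differentiableAt.hasDerivAt he0').deriv
    simpa using! this
  · have hd := hu.deriv.deriv
    have hr : AnalyticAt ℂ (fun z => 2 + 0 * (z ^ 2 / e z) +
      (-3 / 2 * L.g₂) * (z ^ 2 / e z) ^ 2 + (-2 * L.g₃) * (z ^ 2 / e z) ^ 3) 0 := by fun_prop
    refine (ContinuousAt.eventuallyEq_nhds_iff_eventuallyEq_nhdsNE hd.continuousAt
      hr.continuousAt).1 ?_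
    have h1 := eventually_eventually_nhdsWithin.2 (huP.and ((L.eventually_notMem_lattice 0).and
      (L.eventually_weierstrassP_ne L.lattice.zero_mem 0)))
    filter_upwards [h1, self_mem_nhdsWithin] with z hz hz0
    rw [nhdsWithin_eq_nhds.2 (isOpen_compl_singleton.mem_nhds hz0)] at hz
    have h2 : deriv (fun z => z ^ 2 / e z) =ᶠ[𝓝 z]
        fun x => -L.derivWeierstrassP x / L.weierstrassP x ^ 2 := by
      filter_upwards [eventually_eventually_nhds.2 hz] with x hx
      have h3 : (fun z => z ^ 2 / e z) =ᶠ[𝓝 x] fun z => (L.weierstrassP z)⁻¹ :=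
        hx.mono fun y hy => hy.1
      rw [h3.deriv_eq]
      exact ((L.hasDerivAt_weierstrassP hx.self_of_nhds.2.1).fun_inv hx.self_of_nhds.2.2).deriv
    obtain ⟨hzu, hzL, hzP⟩ := hz.self_of_nhds
    rw [h2.deriv_eq, hzu]
    have h4 := ((L.hasDerivAt_derivWeierstrassP hzL).fun_neg.fun_div
      ((L.hasDerivAt_weierstrassP hzL).fun_pow 2) (pow_ne_zero 2 hzP)).deriv
    rw [h4]
    have h5 := L.derivWeierstrassP_sq z hzL
    field_simp
    norm_num
    linear_combination (4 * L.weierstrassP z) * h5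

end PeriodPair

/-! ### Specialising a relation with coefficients in an algebraically closed field -/

theorem aevalAeval_eq_sum {R A : Type*} [CommRing R] [CommRing A] [Algebra R A] (x y : A)
    (p : R[X][Y]) : aevalAeval x y p = ∑ j ∈ Finset.range (p.natDegree + 1),
      (∑ i ∈ Finset.range ((p.coeff j).natDegree + 1),
        algebraMap R A ((p.coeff j).coeff i) * x ^ i) * y ^ j := by
  conv_lhs => rw [p.as_sum_range_C_mul_X_pow]
  rw [map_sum]
  refine Finset.sum_congr rfl fun j _ => ?_
  rw [map_mul, map_pow, aevalAeval_C, aevalAeval_Y, aeval_eq_sum_range]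
  simp_rw [Algebra.smul_def]

theorem aevalAeval_algebraMap_left {R A : Type*} [CommRing R] [CommRing A] [Algebra R A] (x : R)
    (y : A) (p : R[X][Y]) :
    aevalAeval (algebraMap R A x) y p = aeval y (p.map (evalRingHom x)) := by
  induction p using Polynomial.induction_on' with
  | add p q hp hq => simp only [map_add, hp, hq, Polynomial.map_add]
  | monomial n a =>
    rw [← C_mul_X_pow_eq_monomial, map_mul, map_pow, aevalAeval_C, aevalAeval_Y]
    simp [aeval_algebraMap_apply]

theorem aevalAeval_algebraMap_right {R A : Type*} [CommRing R] [CommRing A] [Algebra R A] (x : A)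
    (y : R) (p : R[X][Y]) : aevalAeval x (algebraMap R A y) p = aeval x (p.eval (C y)) := by
  induction p using Polynomial.induction_on' with
  | add p q hp hq => simp only [map_add, hp, hq, eval_add]
  | monomial n a =>
    rw [← C_mul_X_pow_eq_monomial, map_mul, map_pow, aevalAeval_C, aevalAeval_Y]
    simp

namespace PeriodPair

variable (L : PeriodPair)

section

variable {F : IntermediateField Qbar ℂ} (hF : ∀ x, IsAlgebraic F x → x ∈ F) (hg₂ : L.g₂ ∈ F)
  (hg₃ : L.g₃ ∈ F)

include hF hg₂ hg₃ in
/-- The differential equation makes `℘'` algebraic over `℘`. -/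
theorem derivWeierstrassP_mem {z : ℂ} (hz : z ∉ L.lattice) (hzF : L.weierstrassP z ∈ F) :
    L.derivWeierstrassP z ∈ F := by
  apply hF
  have h : L.derivWeierstrassP z ^ 2 ∈ F := by
    rw [L.derivWeierstrassP_sq z hz]
    exact F.sub_mem (F.sub_mem (F.mul_mem (ofNat_mem F 4) (F.pow_mem hzF 3))
      (F.mul_mem hg₂ hzF)) hg₃
  exact (isAlgebraic_algebraMap (⟨_, h⟩ : F)).of_pow two_pos

variable {α w : ℂ} (hα : α ≠ 0) (hαL : ∀ l ∈ L.lattice, α * l ∈ L.lattice) (hαF : α ∈ F)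
  (hw : w ∉ L.lattice) (hwF : L.weierstrassP w ∈ F)

include hF hg₂ hg₃ hα hαL hαF hw hwF

/-- The algebraic relation between `℘(z)` and `℘(α z + w)` has coefficients in `F` if `α`, the
invariants and `℘(w)` are in `F`: the germs at `0` of `1 / ℘(z)` and `℘(α z + w)` have their
derivatives in `F`. -/
theorem exists_polynomial_relation :
    ∃ p : F[X][Y], p ≠ 0 ∧
      ∀ᶠ z in 𝓝[≠] 0, aevalAeval (L.weierstrassP z) (L.weierstrassP (α * z + w)) p = 0 := by
  obtain ⟨N, c, hc0, hc⟩ := L.exists_relation hα hαL hw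
  obtain ⟨u, hu, hu0, hu1, huP, hode⟩ := L.exists_inv_weierstrassP
  have hQ (q : ℚ) : (q : ℂ) ∈ F := by simp
  have huF (n : ℕ) : HasDerivsIn F n u := by
    refine HasDerivsIn.of_ode hu (by rw [hu0]; exact F.zero_mem)
      (by rw [hu1]; exact F.zero_mem) (ofNat_mem F 2) F.zero_mem
      (F.mul_mem ?_ hg₂) (F.mul_mem ?_ hg₃) hode n
    · simpa using hQ (-3 / 2)
    · exact F.neg_mem (ofNat_mem F 2)
  have haff (z : ℂ) : HasDerivAt (fun z => α * z + w) α z := by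
    simpa using ((hasDerivAt_id z).const_mul α).add_const w
  have hev : ∀ᶠ z in 𝓝 (0 : ℂ), α * z + w ∉ L.lattice := by
    have : ContinuousAt (fun z : ℂ => α * z + w) 0 := by fun_prop
    exact this.eventually (L.isClosed_lattice.isOpen_compl.mem_nhds (by simpa using hw))
  have hd1 (z : ℂ) (hz : α * z + w ∉ L.lattice) : HasDerivAt
      (fun z => L.weierstrassP (α * z + w)) (L.derivWeierstrassP (α * z + w) * α) z :=
    HasDerivAt.comp (h₂ := L.weierstrassP) z (L.hasDerivAt_weierstrassP hz) (haff z)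
  have hfF (n : ℕ) : HasDerivsIn F n (fun z => L.weierstrassP (α * z + w)) := by
    refine HasDerivsIn.of_ode (a := -(α ^ 2 * (L.g₂ / 2))) (b := 0) (c := 6 * α ^ 2) (d := 0)
      (L.analyticAt_weierstrassP_affine (by simpa using hw)) (by simpa using hwF) ?_ ?_ F.zero_mem
      ?_ F.zero_mem ?_ n
    · rw [(hd1 0 (by simpa using hw)).deriv]
      simpa using F.mul_mem (L.derivWeierstrassP_mem hF hg₂ hg₃ hw hwF) hαF
    · exact F.neg_mem (F.mul_mem (F.pow_mem hαF 2) (F.div_mem hg₂ (ofNat_mem F 2)))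
    · exact F.mul_mem (ofNat_mem F 6) (F.pow_mem hαF 2)
    · filter_upwards [eventually_eventually_nhds.2 hev] with z hz
      have h2 : deriv (fun z => L.weierstrassP (α * z + w)) =ᶠ[𝓝 z]
          fun z => L.derivWeierstrassP (α * z + w) * α := hz.mono fun x hx => (hd1 x hx).deriv
      rw [h2.deriv_eq]
      have h3 : HasDerivAt (fun z => L.derivWeierstrassP (α * z + w) * α) _ z :=
        (HasDerivAt.comp (h₂ := L.derivWeierstrassP) z
          (L.hasDerivAt_derivWeierstrassP hz.self_of_nhds) (haff z)).mul_const α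
      rw [h3.deriv]
      ring
  -- the relation in terms of `1 / ℘`
  have hrel : ∀ᶠ z in 𝓝[≠] (0 : ℂ), ∀ c : Fin (N + 1) × Fin 3 → ℂ,
      ∑ x, c x * (u z ^ (N - (x.1 : ℕ)) * L.weierstrassP (α * z + w) ^ (x.2 : ℕ)) =
      u z ^ N * ∑ x, c x * (L.weierstrassP z ^ (x.1 : ℕ) *
        L.weierstrassP (α * z + w) ^ (x.2 : ℕ)) := by
    filter_upwards [huP, L.eventually_weierstrassP_ne L.lattice.zero_mem 0] with z hz hP c
    rw [Finset.mul_sum]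
    refine Finset.sum_congr rfl fun x _ => ?_
    have hx1 : (x.1 : ℕ) ≤ N := Nat.lt_succ_iff.1 x.1.2
    have h1 : u z ^ N = u z ^ (N - (x.1 : ℕ)) * u z ^ (x.1 : ℕ) := by
      rw [← pow_add, Nat.sub_add_cancel hx1]
    have h2 : u z ^ (x.1 : ℕ) * L.weierstrassP z ^ (x.1 : ℕ) = 1 := by
      rw [← mul_pow, hz, inv_mul_cancel₀ hP, one_pow]
    rw [h1]
    linear_combination (-(c x) * u z ^ (N - (x.1 : ℕ)) *
      L.weierstrassP (α * z + w) ^ (x.2 : ℕ)) * h2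
  have hpF (x : Fin (N + 1) × Fin 3) (n : ℕ) : HasDerivsIn F n
      (fun z => u z ^ (N - (x.1 : ℕ)) * L.weierstrassP (α * z + w) ^ (x.2 : ℕ)) :=
    ((huF n).pow _).mul ((hfF n).pow _)
  obtain ⟨c', hc'0, hc'⟩ := HasDerivsIn.exists_relation hpF hc0 (by
    have han : AnalyticAt ℂ (fun z => ∑ x, c x * (u z ^ (N - (x.1 : ℕ)) *
        L.weierstrassP (α * z + w) ^ (x.2 : ℕ))) 0 :=
      Finset.analyticAt_fun_sum _ fun x _ => analyticAt_const.mul (hpF x 0).1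
    refine (ContinuousAt.eventuallyEq_nhds_iff_eventuallyEq_nhdsNE han.continuousAt
      continuousAt_const).1 ?_
    filter_upwards [hrel, hc] with z h1 h2
    rw [h1, h2, mul_zero])
  refine ⟨∑ x, C (C (c' x) * X ^ (x.1 : ℕ)) * X ^ (x.2 : ℕ), fun h0 => hc'0 ?_, ?_⟩
  · ext1 y
    have := congrArg (fun p : F[X][Y] => (p.coeff (y.2 : ℕ)).coeff (y.1 : ℕ)) h0
    simp only [finsetSum_coeff, coeff_C_mul_X_pow, coeff_zero] at this
    rw [Finset.sum_eq_single y] at this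
    · simpa using this
    · intro x _ hxy
      split_ifs with h2
      · rw [coeff_C_mul_X_pow, if_neg]
        intro h1
        exact hxy (Prod.ext (Fin.ext h1.symm) (Fin.ext h2.symm))
      · simp
    · simp
  · filter_upwards [hrel, mem_nhdsWithin_of_mem_nhds hc', huP,
      L.eventually_weierstrassP_ne L.lattice.zero_mem 0] with z h1 h2 h3 h4
    have h5 : u z ^ N ≠ 0 := pow_ne_zero _ (by rw [h3]; exact inv_ne_zero h4)
    rw [h1 fun x => (c' x : ℂ)] at h2
    have h6 := (mul_eq_zero.1 h2).resolve_left h5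
    rw [← h6, map_sum]
    refine Finset.sum_congr rfl fun x _ => ?_
    rw [map_mul, map_pow, aevalAeval_C, aevalAeval_Y]
    simp only [map_mul, aeval_C, map_pow, aeval_X, mul_assoc]
    rfl

/-- The relation can be taken irreducible, because the relations satisfied by two meromorphic
germs form a prime ideal. By analytic continuation it holds wherever both functions are
defined. -/
theorem exists_prime_relation : ∃ p : F[X][Y], Prime p ∧ ∀ z, z ∉ L.lattice →
    α * z + w ∉ L.lattice → aevalAeval (L.weierstrassP z) (L.weierstrassP (α * z + w)) p = 0 := by
  let ev (p : F[X][Y]) (z : ℂ) : ℂ := aevalAeval (L.weierstrassP z) (L.weierstrassP (α * z + w)) p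
  have hmer (p : F[X][Y]) : MeromorphicAt (ev p) 0 := by
    have h1 : MeromorphicAt L.weierstrassP 0 := L.meromorphic_weierstrassP 0
    have h2 : MeromorphicAt (fun z => L.weierstrassP (α * z + w)) 0 :=
      (L.analyticAt_weierstrassP_affine (by simpa using hw)).meromorphicAt
    simp only [ev, aevalAeval_eq_sum]
    fun_prop
  let I : Ideal F[X][Y] :=
    { carrier := {p | ∀ᶠ z in 𝓝[≠] 0, ev p z = 0}
      add_mem' := fun {p q} hp hq => by
        show ∀ᶠ z in 𝓝[≠] 0, ev (p + q) z = 0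
        filter_upwards [hp, hq] with z h1 h2
        simp only [ev, map_add] at *
        rw [h1, h2, add_zero]
      zero_mem' := by simp [ev]
      smul_mem' := fun p q hq => by
        show ∀ᶠ z in 𝓝[≠] 0, ev (p • q) z = 0
        filter_upwards [hq] with z h1
        simp only [ev, smul_eq_mul, map_mul] at *
        rw [h1, mul_zero] }
  have hI : I.IsPrime := by
    refine ⟨fun h => ?_, fun {p q} hpq => ?_⟩
    · have : (1 : F[X][Y]) ∈ I := h ▸ Submodule.mem_top
      have : ∀ᶠ z in 𝓝[≠] (0 : ℂ), ev 1 z = 0 := this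
      obtain ⟨z, hz⟩ := this.exists
      simp [ev] at hz
    · rcases (hmer p).eventually_eq_zero_or_eventually_ne_zero with h | h
      · exact Or.inl h
      · right
        have hpq : ∀ᶠ z in 𝓝[≠] (0 : ℂ), ev (p * q) z = 0 := hpq
        show ∀ᶠ z in 𝓝[≠] (0 : ℂ), ev q z = 0
        filter_upwards [h, hpq] with z h1 h2
        simp only [ev, map_mul] at *
        exact (mul_eq_zero.1 h2).resolve_left h1
  obtain ⟨p₀, hp₀, hp₀I⟩ := L.exists_polynomial_relation hF hg₂ hg₃ hα hαL hαF hw hwF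
  obtain ⟨p, hpI, hp⟩ := hI.exists_mem_prime_of_ne_bot
    ((Submodule.ne_bot_iff _).2 ⟨p₀, hp₀I, hp₀⟩)
  refine ⟨p, hp, fun z hz1 hz2 => ?_⟩
  -- analytic continuation from a punctured neighbourhood of `0`
  let s : Set ℂ := (L.lattice : Set ℂ) ∪ {z | α * z + w ∈ L.lattice}
  have hs : s.Countable := L.countable_lattice.union
    (L.countable_lattice.preimage_of_injOn (f := fun z => α * z + w)
      fun x _ y _ hxy => mul_left_cancel₀ hα (add_right_cancel hxy))
  have han : AnalyticOnNhd ℂ (ev p) sᶜ := fun x hx => by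
    have hx' : x ∉ L.lattice ∧ α * x + w ∉ L.lattice := not_or.1 hx
    have h1 := L.analyticOnNhd_weierstrassP x hx'.1
    have h2 := L.analyticAt_weierstrassP_affine hx'.2
    simp only [ev, aevalAeval_eq_sum]
    refine Finset.analyticAt_fun_sum _ fun j _ => AnalyticAt.fun_mul
      (Finset.analyticAt_fun_sum _ fun i _ => ?_) (h2.fun_pow j)
    exact analyticAt_const.fun_mul (h1.fun_pow i)
  have hev : ∀ᶠ z in 𝓝 (0 : ℂ), α * z + w ∉ L.lattice := by
    have : ContinuousAt (fun z : ℂ => α * z + w) 0 := by fun_prop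
    exact this.eventually (L.isClosed_lattice.isOpen_compl.mem_nhds (by simpa using hw))
  have hpI : ∀ᶠ z in 𝓝[≠] (0 : ℂ), ev p z = 0 := hpI
  obtain ⟨y, hy, hy1, hy2, hy0⟩ := ((eventually_eventually_nhdsWithin.2 hpI).and
    ((L.eventually_notMem_lattice 0).and ((hev.filter_mono nhdsWithin_le_nhds).and
      self_mem_nhdsWithin))).exists
  rw [nhdsWithin_eq_nhds.2 (isOpen_compl_singleton.mem_nhds hy0)] at hy
  exact han.eqOn_zero_of_preconnected_of_eventuallyEq_zero
    (isPreconnected_compl_of_countable hs) (z₀ := y) (fun h => h.elim hy1 hy2) hy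
    (show z ∈ sᶜ from fun h => h.elim hz1 hz2)

/-- An algebraically closed field that contains `α`, the invariants and `℘(w)` contains
`℘(α z + w)` if and only if it contains `℘(z)`. In an irreducible relation between the two, the
specialisation of one variable is not zero, because otherwise the relation would be linear in that
variable alone and one of the two functions would be constant. -/
theorem weierstrassP_affine_mem_iff {z : ℂ} (hz : z ∉ L.lattice) (hz' : α * z + w ∉ L.lattice) :
    L.weierstrassP (α * z + w) ∈ F ↔ L.weierstrassP z ∈ F := by
  obtain ⟨p, hp, hpz⟩ := L.exists_prime_relation hF hg₂ hg₃ hα hαL hαF hw hwF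
  have hcont : ContinuousAt (fun x : ℂ => α * x + w) z := by fun_prop
  have hev : ∀ᶠ x in 𝓝 z, x ∉ L.lattice ∧ α * x + w ∉ L.lattice :=
    Filter.Eventually.and (L.isClosed_lattice.isOpen_compl.mem_nhds hz)
      (hcont.eventually (L.isClosed_lattice.isOpen_compl.mem_nhds hz'))
  constructor
  · intro hy
    have h1 := hpz z hz hz'
    have h2 := aevalAeval_algebraMap_right (A := ℂ) (L.weierstrassP z) (⟨_, hy⟩ : F) p
    rw [show algebraMap F ℂ ⟨_, hy⟩ = L.weierstrassP (α * z + w) from rfl, h1] at h2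
    refine hF _ ⟨_, fun h0 => ?_, h2.symm⟩
    -- otherwise `p` is associated to `Y - ℘(α z + w)` and `℘(α x + w)` does not depend on `x`
    have h3 : (X - C (C ⟨_, hy⟩) : F[X][Y]) ∣ p := dvd_iff_isRoot.2 h0
    have h4 : p ∣ (X - C (C ⟨_, hy⟩) : F[X][Y]) :=
      (irreducible_X_sub_C _).dvd_symm hp.irreducible h3
    obtain ⟨q, hq⟩ := h4
    have hq' : (X : F[X][Y]) = p * q + C (C ⟨_, hy⟩) := by rw [← hq, sub_add_cancel]
    have h5 : ∀ᶠ x in 𝓝 z, L.weierstrassP (α * x + w) = L.weierstrassP (α * z + w) := by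
      filter_upwards [hev] with x hx
      have h6 := congrArg (aevalAeval (L.weierstrassP x) (L.weierstrassP (α * x + w))) hq'
      rw [map_add, map_mul, hpz x hx.1 hx.2, zero_mul, zero_add, aevalAeval_Y, aevalAeval_C,
        aeval_C] at h6
      exact h6
    refine L.not_eventually_weierstrassP_eq hz' _ (?_ : ∀ᶠ y in 𝓝 (α * z + w),
      L.weierstrassP y = L.weierstrassP (α * z + w))
    have h7 : Tendsto (fun y => (y - w) / α) (𝓝 (α * z + w)) (𝓝 z) := by
      have : ContinuousAt (fun y : ℂ => (y - w) / α) (α * z + w) := by fun_prop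
      have h8 := this.tendsto
      rwa [add_sub_cancel_right, mul_div_cancel_left₀ _ hα] at h8
    filter_upwards [h7.eventually h5] with y hy
    rwa [mul_div_cancel₀ _ hα, sub_add_cancel] at hy
  · intro hx
    have h1 := hpz z hz hz'
    have h2 := aevalAeval_algebraMap_left (A := ℂ) (⟨_, hx⟩ : F) (L.weierstrassP (α * z + w)) p
    rw [show algebraMap F ℂ ⟨_, hx⟩ = L.weierstrassP z from rfl, h1] at h2
    refine hF _ ⟨_, fun h0 => ?_, h2.symm⟩
    -- otherwise `p` is associated to `X - ℘(z)` and `℘(x)` does not depend on `x`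
    have h3 : C (X - C ⟨_, hx⟩ : F[X]) ∣ p := by
      rw [C_dvd_iff_dvd_coeff]
      intro i
      rw [dvd_iff_isRoot]
      have := congrArg (fun q => q.coeff i) h0
      simpa using this
    have h4 : p ∣ C (X - C ⟨_, hx⟩ : F[X]) :=
      ((prime_C_iff.2 (prime_X_sub_C _)).irreducible).dvd_symm hp.irreducible h3
    obtain ⟨q, hq⟩ := h4
    refine L.not_eventually_weierstrassP_eq hz (L.weierstrassP z) ?_
    filter_upwards [hev] with x hx
    have h6 := congrArg (aevalAeval (L.weierstrassP x) (L.weierstrassP (α * x + w))) hq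
    rw [map_mul, hpz x hx.1 hx.2, zero_mul, aevalAeval_C, map_sub, aeval_X, aeval_C] at h6
    exact sub_eq_zero.1 h6

end

end PeriodPair

end

namespace PeriodPair

variable (L : PeriodPair)

/-! ### The endomorphism field -/

theorem ω₁_ne_zero : L.ω₁ ≠ 0 := fun h =>
  L.ω₁_div_two_notMem_lattice (by rw [h, zero_div]; exact L.lattice.zero_mem)

/-- A multiplier of the lattice is a root of the characteristic polynomial of its action. -/
theorem exists_int_quadratic {α : ℂ} (hα : ∀ l ∈ L.lattice, α * l ∈ L.lattice) :
    ∃ a b t n : ℤ, α * L.ω₁ = a * L.ω₁ + b * L.ω₂ ∧ α ^ 2 - t * α + n = 0 := by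
  obtain ⟨a, b, hab⟩ := mem_lattice.1 (hα _ L.ω₁_mem_lattice)
  obtain ⟨c, d, hcd⟩ := mem_lattice.1 (hα _ L.ω₂_mem_lattice)
  refine ⟨a, b, a + d, a * d - b * c, hab.symm, mul_right_cancel₀ L.ω₁_ne_zero ?_⟩
  push_cast
  linear_combination (d - α) * hab - b * hcd

open Polynomial in
theorem isAlgebraic_of_mul_lattice {α : ℂ} (hα : ∀ l ∈ L.lattice, α * l ∈ L.lattice) :
    IsAlgebraic ℚ α := by
  obtain ⟨-, -, t, n, -, h⟩ := L.exists_int_quadratic hα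
  refine ⟨X ^ 2 - C (t : ℚ) * X + C (n : ℚ), ?_, by simpa using h⟩
  intro h0
  have := congrArg (fun p => p.coeff 2) h0
  simp [-eq_intCast, -map_intCast] at this

theorem endField_le : L.endField ≤ algebraicClosure ℚ ℂ :=
  IntermediateField.adjoin_le_iff.2 fun _ hα =>
    mem_algebraicClosure_iff.2 (L.isAlgebraic_of_mul_lattice hα)

theorem isAlgebraic_of_mem_endField {k : ℂ} (hk : k ∈ L.endField) : IsAlgebraic ℚ k :=
  mem_algebraicClosure_iff.1 (L.endField_le hk)

theorem endField_toSubalgebra : L.endField.toSubalgebra =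
    Algebra.adjoin ℚ {α : ℂ | ∀ l ∈ L.lattice, α * l ∈ L.lattice} :=
  IntermediateField.adjoin_toSubalgebra_of_isAlgebraic fun _ hα => L.isAlgebraic_of_mul_lattice hα

/-! ### Points with `℘`-value in an algebraically closed field -/

/-- The points of `ℂ` at which `℘` takes a value in `F ∪ {∞}`. -/
def pointsIn (F : IntermediateField Qbar ℂ) : Set ℂ := {z | z ∈ L.lattice ∨ L.weierstrassP z ∈ F}

section

variable {F : IntermediateField Qbar ℂ} (hF : ∀ x, IsAlgebraic F x → x ∈ F) (hg₂ : L.g₂ ∈ F)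
  (hg₃ : L.g₃ ∈ F)

/-- The derivative of `℘` vanishes at the half periods; at those in `Λ` it has the junk value
`0`. -/
theorem derivWeierstrassP_half {l : ℂ} (hl : l ∈ L.lattice) : L.derivWeierstrassP (l / 2) = 0 := by
  have h1 := L.derivWeierstrassP_neg (l / 2)
  have h2 := L.derivWeierstrassP_add_coe (-(l / 2)) ⟨l, hl⟩
  rw [h1] at h2
  have h3 : -(l / 2) + l = l / 2 := by ring
  simp only [h3] at h2
  linear_combination h2 / 2

include hF hg₂ hg₃

open Polynomial in
/-- The values of `℘` at the half periods are the roots of `4 X³ - g₂ X - g₃`. -/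
theorem half_mem_pointsIn {l : ℂ} (hl : l ∈ L.lattice) : l / 2 ∈ L.pointsIn F := by
  by_cases hl2 : l / 2 ∈ L.lattice
  · exact Or.inl hl2
  refine Or.inr (hF _ ⟨C 4 * X ^ 3 - C ⟨_, hg₂⟩ * X - C ⟨_, hg₃⟩, ?_, ?_⟩)
  · intro h0
    have := congrArg (fun p => p.coeff 3) h0
    simp [-eq_intCast, -map_intCast] at this
  · have h1 := L.derivWeierstrassP_sq _ hl2
    rw [L.derivWeierstrassP_half hl, zero_pow two_ne_zero] at h1
    have h4 : algebraMap F ℂ 4 = 4 := map_ofNat _ 4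
    simp only [map_sub, map_mul, aeval_C, map_pow, aeval_X, h4]
    exact h1.symm

/-- A weak form of the addition theorem of `℘`. -/
theorem add_mem_pointsIn {z w : ℂ} (hz : z ∈ L.pointsIn F) (hw : w ∈ L.pointsIn F) :
    z + w ∈ L.pointsIn F := by
  by_cases hwL : w ∈ L.lattice
  · refine hz.imp (fun h => add_mem h hwL) fun h => ?_
    rwa [L.weierstrassP_add hwL]
  by_cases hzL : z ∈ L.lattice
  · right
    rw [add_comm, L.weierstrassP_add hzL]
    exact hw.resolve_left hwL
  by_cases hzw : z + w ∈ L.lattice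
  · exact Or.inl hzw
  have := L.weierstrassP_affine_mem_iff hF hg₂ hg₃ (α := 1) one_ne_zero
    (fun l hl => by rwa [one_mul]) F.one_mem hwL (hw.resolve_left hwL) hzL (by rwa [one_mul])
  rw [one_mul] at this
  exact Or.inr (this.2 (hz.resolve_left hzL))

omit hF hg₂ hg₃ in
theorem neg_mem_pointsIn {z : ℂ} (hz : z ∈ L.pointsIn F) : -z ∈ L.pointsIn F := by
  refine hz.imp (fun h => neg_mem h) fun h => ?_
  rwa [L.weierstrassP_neg]

/-- A weak form of complex multiplication. The half period keeps the translate `w` in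
`weierstrassP_affine_mem_iff` off the lattice. -/
theorem mul_mem_pointsIn {α z : ℂ} (hα : ∀ l ∈ L.lattice, α * l ∈ L.lattice)
    (hz : z ∈ L.pointsIn F) : α * z ∈ L.pointsIn F := by
  by_cases hα0 : α = 0
  · exact Or.inl (by simp [hα0])
  by_cases hzL : z ∈ L.lattice
  · exact Or.inl (hα z hzL)
  have hw := L.half_mem_pointsIn hF hg₂ hg₃ L.ω₁_mem_lattice
  have key : α * z + L.ω₁ / 2 ∈ L.pointsIn F := by
    by_cases h : α * z + L.ω₁ / 2 ∈ L.lattice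
    · exact Or.inl h
    · exact Or.inr ((L.weierstrassP_affine_mem_iff hF hg₂ hg₃ hα0 hα
        (mem_of_isAlgebraic_rat F (L.isAlgebraic_of_mul_lattice hα)) L.ω₁_div_two_notMem_lattice
        (hw.resolve_left L.ω₁_div_two_notMem_lattice) hzL h).2 (hz.resolve_left hzL))
  have := L.add_mem_pointsIn hF hg₂ hg₃ key (L.neg_mem_pointsIn hw)
  rwa [add_neg_cancel_right] at this

theorem mem_pointsIn_of_mul_mem {α z : ℂ} (hα0 : α ≠ 0) (hα : ∀ l ∈ L.lattice, α * l ∈ L.lattice)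
    (hz : α * z ∈ L.pointsIn F) : z ∈ L.pointsIn F := by
  by_cases hzL : z ∈ L.lattice
  · exact Or.inl hzL
  -- translate by a half period that avoids the pole of `℘`
  obtain ⟨w, hwL, hw, hzw⟩ : ∃ w ∉ L.lattice, w ∈ L.pointsIn F ∧ α * z + w ∉ L.lattice := by
    by_cases h : α * z + L.ω₁ / 2 ∈ L.lattice
    · refine ⟨L.ω₂ / 2, L.ω₂_div_two_notMem_lattice,
        L.half_mem_pointsIn hF hg₂ hg₃ L.ω₂_mem_lattice, fun h' => ?_⟩
      have h3 := (L.mul_ω₁_add_mul_ω₂_mem_lattice (α := 1 / 2) (β := -1 / 2)).not.2 (by norm_num)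
      apply h3
      convert sub_mem h h' using 1
      push_cast
      ring
    · exact ⟨_, L.ω₁_div_two_notMem_lattice,
        L.half_mem_pointsIn hF hg₂ hg₃ L.ω₁_mem_lattice, h⟩
  have h1 := L.add_mem_pointsIn hF hg₂ hg₃ hz hw
  exact Or.inr ((L.weierstrassP_affine_mem_iff hF hg₂ hg₃ hα0 hα
    (mem_of_isAlgebraic_rat F (L.isAlgebraic_of_mul_lattice hα)) hwL (hw.resolve_left hwL)
    hzL hzw).1 (h1.resolve_left hzw))

theorem endField_mul_mem_pointsIn {k z : ℂ} (hk : k ∈ L.endField) (hz : z ∈ L.pointsIn F) :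
    k * z ∈ L.pointsIn F := by
  have hint (n : ℤ) : ∀ l ∈ L.lattice, (n : ℂ) * l ∈ L.lattice := fun l hl => by
    rw [← zsmul_eq_mul]; exact L.lattice.smul_mem n hl
  rw [← IntermediateField.mem_toSubalgebra, L.endField_toSubalgebra] at hk
  induction hk using Algebra.adjoin_induction generalizing z with
  | mem α hα => exact L.mul_mem_pointsIn hF hg₂ hg₃ hα hz
  | algebraMap r =>
    have hden : ((r.den : ℤ) : ℂ) ≠ 0 := by simp
    refine L.mem_pointsIn_of_mul_mem hF hg₂ hg₃ hden (hint _) ?_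
    have h1 := L.mul_mem_pointsIn hF hg₂ hg₃ (hint r.num) hz
    convert h1 using 1
    rw [← mul_assoc]
    congr 1
    rw [eq_ratCast]
    exact_mod_cast Rat.den_mul_eq_num r
  | add x y _ _ hx hy => rw [add_mul]; exact L.add_mem_pointsIn hF hg₂ hg₃ (hx hz) (hy hz)
  | mul x y _ _ hx hy => rw [mul_assoc]; exact hx (hy hz)

/-- If `F` is algebraically closed and contains the invariants of the lattice, the points at which
`℘` takes a value in `F ∪ {∞}` form a vector space over the field of endomorphisms. -/
def pointsSubmodule : Submodule L.endField ℂ where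
  carrier := L.pointsIn F
  add_mem' := L.add_mem_pointsIn hF hg₂ hg₃
  zero_mem' := Or.inl L.lattice.zero_mem
  smul_mem' k _ hz := L.endField_mul_mem_pointsIn hF hg₂ hg₃ k.2 hz

end

/-! ### The rank inequality -/

theorem mem_algClosureAdjoin_closed (S : Set ℂ) :
    ∀ x, IsAlgebraic (algClosureAdjoin S) x → x ∈ algClosureAdjoin S :=
  fun _ hx => mem_algClosureAdjoin_of_isAlgebraic hx

/-- An intermediate field of `ℂ / Q̄` as a vector space over the field of endomorphisms. -/
def fieldSubmodule (F : IntermediateField Qbar ℂ) : Submodule L.endField ℂ where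
  carrier := F
  add_mem' := F.add_mem
  zero_mem' := F.zero_mem
  smul_mem' k _ hx := F.mul_mem (mem_of_isAlgebraic_rat F (L.isAlgebraic_of_mem_endField k.2)) hx

theorem pointsIn_mono {F F' : IntermediateField Qbar ℂ} (h : (F : Set ℂ) ⊆ F') :
    L.pointsIn F ⊆ L.pointsIn F' := fun _ hz => hz.imp_right fun h' => h h'

/-- The form in which either version of the elliptic Schanuel conjecture is used: a
finite-dimensional space `Y` over the field of endomorphisms such that `Y` and the values of `℘`
on `Y` are algebraic over the field generated by a finite set `S` has dimension at most `#S`. -/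
def RankInequality : Prop :=
  ∀ (Y : Submodule L.endField ℂ) [FiniteDimensional L.endField Y] (S : Finset ℂ),
    (Y : Set ℂ) ⊆ (algClosureAdjoin (S : Set ℂ) : Set ℂ) →
    (Y : Set ℂ) ⊆ L.pointsIn (algClosureAdjoin (S : Set ℂ)) →
    Module.finrank L.endField Y ≤ S.card

theorem exists_div_notMem_lattice {x : ℂ} (hx : x ≠ 0) :
    ∃ n : ℕ, x / ((n : ℂ) + 1) ∉ L.lattice := by
  have h1 : Tendsto (fun n : ℕ => x / ((n : ℂ) + 1)) atTop (𝓝[≠] 0) := by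
    refine tendsto_nhdsWithin_of_tendsto_nhds_of_eventually_within _ ?_ ?_
    · have := (tendsto_one_div_add_atTop_nhds_zero_nat (𝕜 := ℂ)).const_mul x
      simpa [div_eq_mul_inv] using this
    · exact Eventually.of_forall fun n => div_ne_zero hx (Nat.cast_add_one_ne_zero n)
  exact (h1.eventually (L.eventually_notMem_lattice 0)).exists

/-- A basis can be moved off the lattice by dividing its members by integers. -/
theorem exists_basis_notMem_lattice (Y : Submodule L.endField ℂ) [FiniteDimensional L.endField Y] :
    ∃ b : Module.Basis (Fin (Module.finrank L.endField Y)) L.endField Y,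
      ∀ i, (b i : ℂ) ∉ L.lattice := by
  let b := Module.finBasis L.endField Y
  have h (i) : ∃ n : ℕ, (b i : ℂ) / ((n : ℂ) + 1) ∉ L.lattice :=
    L.exists_div_notMem_lattice fun h0 => b.ne_zero i (Subtype.ext h0)
  choose n hn using h
  have hu (i) : (((n i : L.endField) + 1)⁻¹ : L.endField) ≠ 0 :=
    inv_ne_zero (Nat.cast_add_one_ne_zero _)
  refine ⟨b.unitsSMul fun i => Units.mk0 _ (hu i), fun i => ?_⟩
  rw [Module.Basis.unitsSMul_apply]
  convert hn i using 2
  rw [div_eq_inv_mul]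
  rfl

theorem subset_of_basis_mem {Y : Submodule L.endField ℂ} {ι : Type*}
    (b : Module.Basis ι L.endField Y) {N : Submodule L.endField ℂ} (h : ∀ i, (b i : ℂ) ∈ N) :
    Y ≤ N := by
  intro y hy
  have : (⊤ : Submodule L.endField Y) ≤ N.comap Y.subtype := by
    rw [← b.span_eq, Submodule.span_le]
    rintro _ ⟨i, rfl⟩
    exact h i
  exact this (Submodule.mem_top (x := (⟨y, hy⟩ : Y)))

section

variable (hg₂ : IsAlgebraic ℚ L.g₂) (hg₃ : IsAlgebraic ℚ L.g₃)

include hg₂ hg₃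

/-- The weak conjecture, applied to a basis of `Y` outside `Λ`. -/
theorem WeakEllipticSchanuel.rankInequality (h : L.WeakEllipticSchanuel) : L.RankInequality := by
  intro Y _ S hY hYP
  rcases Nat.eq_zero_or_pos (Module.finrank L.endField Y) with h0 | hpos
  · omega
  obtain ⟨b, hb⟩ := L.exists_basis_notMem_lattice Y
  have h1 := h _ (fun i => (b i : ℂ)) hpos hb
    (b.linearIndependent.map' Y.subtype (Submodule.ker_subtype Y))
  have h2 := h1.trans (trdeg_adjoin_le (S := S) ?_)
  · exact_mod_cast h2
  · rintro x ((hx | ⟨i, rfl⟩) | ⟨i, rfl⟩)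
    · apply mem_of_isAlgebraic_rat
      rcases hx with rfl | rfl
      exacts [hg₂, hg₃]
    · exact hY (b i).2
    · exact (hYP (b i).2).resolve_left (hb i)

/-- The span of an algebraic period would contradict the rank inequality with `S` empty. -/
theorem RankInequality.not_isAlgebraic_period (h : L.RankInequality) {x : ℂ} (hx : x ∈ L.lattice)
    (hx0 : x ≠ 0) : ¬ IsAlgebraic ℚ x := by
  intro halg
  let F := algClosureAdjoin ((∅ : Finset ℂ) : Set ℂ)
  have h1 : Submodule.span L.endField {x} ≤ L.fieldSubmodule F := by
    rw [Submodule.span_le, Set.singleton_subset_iff]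
    exact mem_of_isAlgebraic_rat _ halg
  have h2 : Submodule.span L.endField {x} ≤ L.pointsSubmodule (mem_algClosureAdjoin_closed _)
      (mem_of_isAlgebraic_rat F hg₂) (mem_of_isAlgebraic_rat F hg₃) := by
    rw [Submodule.span_le, Set.singleton_subset_iff]
    exact Or.inl hx
  have h3 := h _ ∅ h1 h2
  rw [finrank_span_singleton hx0] at h3
  simp at h3

end

/-! ### Finite generation in the towers -/

/-- A finite subset of `Eₘ₊₁` is algebraic over the values of `℘` at finitely many points of `Eₘ`,
and the points can be chosen to be algebraic over these values themselves. -/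
theorem exists_finite_of_subset_towerE_succ {m : ℕ}
    (ih : ∀ X : Set ℂ, X.Finite → X ⊆ L.towerE m → ∃ A : Set ℂ, A.Finite ∧ A ⊆ L.towerE m ∧
      (∀ a ∈ A, a ∉ L.lattice) ∧ X ∪ A ⊆ (algClosureAdjoin (L.weierstrassP '' A) : Set ℂ))
    {X : Set ℂ} (hX : X.Finite) (hXE : X ⊆ L.towerE (m + 1)) :
    ∃ A : Set ℂ, A.Finite ∧ A ⊆ L.towerE m ∧ (∀ a ∈ A, a ∉ L.lattice) ∧
      X ∪ A ⊆ (algClosureAdjoin (L.weierstrassP '' A) : Set ℂ) := by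
  obtain ⟨T, hT, hTfin, hXT⟩ := exists_finite_of_mem_algClosureAdjoin hX hXE
  have h1 : T \ L.towerE m ⊆ L.weierstrassP '' ((L.towerE m : Set ℂ) \ (L.lattice : Set ℂ)) :=
    fun x hx => (hT hx.1).resolve_left hx.2
  obtain ⟨A₀, hA₀, hA₀fin, hTA₀⟩ : ∃ A₀ ⊆ (L.towerE m : Set ℂ) \ (L.lattice : Set ℂ), A₀.Finite ∧
      T \ L.towerE m ⊆ L.weierstrassP '' A₀ := by
    exact Set.exists_subset_image_finite_and.1 ⟨_, h1, hTfin.sdiff, subset_rfl⟩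
  obtain ⟨A₁, hA₁fin, hA₁E, hA₁L, hA₁⟩ := ih ((T ∩ L.towerE m) ∪ A₀)
    ((hTfin.inter_of_left _).union hA₀fin)
    (Set.union_subset Set.inter_subset_right fun a ha => (hA₀ ha).1)
  have hmono : (algClosureAdjoin (L.weierstrassP '' A₁) : Set ℂ) ⊆
      algClosureAdjoin (L.weierstrassP '' (A₀ ∪ A₁)) :=
    algClosureAdjoin_mono (Set.image_mono Set.subset_union_right)
  refine ⟨A₀ ∪ A₁, hA₀fin.union hA₁fin, Set.union_subset (fun a ha => (hA₀ ha).1) hA₁E,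
    fun a ha => ha.elim (fun h => (hA₀ h).2) (hA₁L a), ?_⟩
  refine Set.union_subset (hXT.trans (algClosureAdjoin_subset_of_subset fun x hx => ?_))
    (Set.union_subset (fun a ha => hmono (hA₁ (Or.inl (Or.inr ha))))
      fun a ha => hmono (hA₁ (Or.inr ha)))
  by_cases hxE : x ∈ (L.towerE m : Set ℂ)
  · exact hmono (hA₁ (Or.inl (Or.inl ⟨hx, hxE⟩)))
  · exact subset_algClosureAdjoin _ (Set.image_mono Set.subset_union_left (hTA₀ ⟨hx, hxE⟩))

theorem exists_finite_of_subset_towerE (m : ℕ) : ∀ X : Set ℂ, X.Finite → X ⊆ L.towerE m →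
    ∃ A : Set ℂ, A.Finite ∧ A ⊆ L.towerE m ∧ (∀ a ∈ A, a ∉ L.lattice) ∧
      X ∪ A ⊆ (algClosureAdjoin (L.weierstrassP '' A) : Set ℂ) := by
  induction m with
  | zero =>
    intro X _ hX
    refine ⟨∅, Set.finite_empty, by simp, by simp, ?_⟩
    rw [Set.image_empty, Set.union_empty, coe_algClosureAdjoin_empty]
    exact hX
  | succ m ih =>
    intro X hX hXE
    obtain ⟨A, h1, h2, h3⟩ := L.exists_finite_of_subset_towerE_succ ih hX hXE
    exact ⟨A, h1, h2.trans (L.towerE_mono m.le_succ), h3⟩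

/-- A finite subset of `Lₙ` is algebraic over a finite subset `B` of `Lₙ` such that the values of
`℘` on `B` are algebraic over `B` as well. -/
theorem exists_finite_of_subset_towerL (n : ℕ) : ∀ Z : Set ℂ, Z.Finite → Z ⊆ L.towerL n →
    ∃ B : Set ℂ, B.Finite ∧ B ⊆ L.towerL n ∧ Z ⊆ (algClosureAdjoin B : Set ℂ) ∧
      B ⊆ L.pointsIn (algClosureAdjoin B) := by
  induction n with
  | zero =>
    intro Z hZ hZL
    obtain ⟨B, hB, hBfin, hZB⟩ := exists_finite_of_mem_algClosureAdjoin hZ hZL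
    exact ⟨B, hBfin, hB.trans (subset_algClosureAdjoin _), hZB, fun b hb => Or.inl (hB hb)⟩
  | succ n ih =>
    intro Z hZ hZL
    obtain ⟨T, hT, hTfin, hZT⟩ := exists_finite_of_mem_algClosureAdjoin hZ hZL
    obtain ⟨B, hBfin, hBL, hB, hBP⟩ := ih ((T ∪ L.weierstrassP '' T) ∩ L.towerL n)
      ((hTfin.union (hTfin.image _)).inter_of_left _) Set.inter_subset_right
    have hmono : (algClosureAdjoin B : Set ℂ) ⊆ algClosureAdjoin (B ∪ T \ L.towerL n) :=
      algClosureAdjoin_mono Set.subset_union_left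
    refine ⟨B ∪ T \ L.towerL n, hBfin.union hTfin.sdiff, ?_, ?_, ?_⟩
    · refine Set.union_subset (hBL.trans (L.towerL_mono n.le_succ)) fun x hx => ?_
      exact subset_algClosureAdjoin _ (hT hx.1)
    · refine hZT.trans (algClosureAdjoin_subset_of_subset fun x hx => ?_)
      by_cases hxL : x ∈ (L.towerL n : Set ℂ)
      · exact hmono (hB ⟨Or.inl hx, hxL⟩)
      · exact subset_algClosureAdjoin _ (Or.inr ⟨hx, hxL⟩)
    · refine Set.union_subset (hBP.trans (L.pointsIn_mono hmono)) fun x hx => ?_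
      exact ((hT hx.1).resolve_left hx.2).imp_right fun h =>
        hmono (hB ⟨Or.inr ⟨x, hx.1, rfl⟩, h⟩)

theorem exists_subset_of_finite_subset_iUnion {α : Type*} {s : ℕ → Set α} (hs : Monotone s)
    {X : Set α} (hX : X.Finite) (h : X ⊆ ⋃ n, s n) : ∃ n, X ⊆ s n := by
  have h' : ∀ x ∈ X, ∃ n, x ∈ s n := fun x hx => Set.mem_iUnion.1 (h hx)
  choose! n hn using h'
  obtain ⟨N, hN⟩ := (hX.image n).bddAbove
  exact ⟨N, fun x hx => hs (hN (Set.mem_image_of_mem n hx)) (hn x hx)⟩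

theorem exists_finite_of_subset_fieldL {Z : Set ℂ} (hZ : Z.Finite) (hZL : Z ⊆ L.fieldL) :
    ∃ B : Set ℂ, B.Finite ∧ B ⊆ L.fieldL ∧ Z ⊆ (algClosureAdjoin B : Set ℂ) ∧
      B ⊆ L.pointsIn (algClosureAdjoin B) := by
  have hle (n : ℕ) : (L.towerL n : Set ℂ) ⊆ L.fieldL := by
    rw [coe_fieldL]; exact Set.subset_iUnion (fun n => (L.towerL n : Set ℂ)) n
  obtain ⟨n, hn⟩ : ∃ n, Z ⊆ L.towerL n := by
    rw [coe_fieldL] at hZL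
    exact exists_subset_of_finite_subset_iUnion (fun _ _ h => L.towerL_mono h) hZ hZL
  obtain ⟨B, h1, h2, h3⟩ := L.exists_finite_of_subset_towerL n Z hZ hn
  exact ⟨B, h1, h2.trans (hle n), h3⟩

/-! ### Linear disjointness -/

/-- The induction step. With `A ⊆ Eₘ` and `B` from the finite generation lemmas, let `V` be the
span of `A` and `W₁` a complement of the algebraic numbers in the span of `B`. As `Eₘ` and the
field `L` meet in `Q̄`, the sum `V + W₁` is direct. It and the values of `℘` on it are algebraic
over the values of `℘` at a basis of `V` together with a basis of `W₁`, so the rank inequality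
makes this family, which has `dim (V + W₁)` members, algebraically independent. -/
theorem RankInequality.exists_algebraicIndependent (h : L.RankInequality)
    (hg₂ : IsAlgebraic ℚ L.g₂) (hg₃ : IsAlgebraic ℚ L.g₃) {m : ℕ}
    (ih : (L.towerE m).LinearDisjoint L.fieldL) {X Z : Set ℂ} (hX : X.Finite) (hZ : Z.Finite)
    (hXE : X ⊆ L.towerE (m + 1)) (hZL : Z ⊆ L.fieldL) :
    ∃ (σ τ : Type) (s : σ → ℂ) (t : τ → ℂ), AlgebraicIndependent Qbar (Sum.elim s t) ∧
        X ⊆ (algClosureAdjoin (Set.range s) : Set ℂ) ∧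
        Z ⊆ (algClosureAdjoin (Set.range t) : Set ℂ) := by
  obtain ⟨A, hAfin, hAE, hAL, hXA⟩ := L.exists_finite_of_subset_towerE_succ
    (L.exists_finite_of_subset_towerE m) hX hXE
  obtain ⟨B, hBfin, hBL, hZB, hBP⟩ := L.exists_finite_of_subset_fieldL hZ hZL
  let pts (S : Set ℂ) : Submodule L.endField ℂ :=
    L.pointsSubmodule (mem_algClosureAdjoin_closed S)
      (mem_of_isAlgebraic_rat _ hg₂) (mem_of_isAlgebraic_rat _ hg₃)
  let V := Submodule.span L.endField A
  let W := Submodule.span L.endField B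
  let D := L.fieldSubmodule ⊥
  have hD (S : Set ℂ) : D ≤ L.fieldSubmodule (algClosureAdjoin S) := fun x hx =>
    mem_of_isAlgebraic_rat _ (isAlgebraic_rat_of_mem_bot hx)
  have : FiniteDimensional L.endField V := FiniteDimensional.span_of_finite _ hAfin
  have : FiniteDimensional L.endField W := FiniteDimensional.span_of_finite _ hBfin
  -- a complement in `W` of the algebraic numbers that `W` contains
  obtain ⟨W₁, hDW₁, hW₁⟩ := exists_disjoint_sup_eq (inf_le_left : W ⊓ D ≤ W)
  have hW₁W : W₁ ≤ W := le_sup_right.trans hW₁.le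
  have : FiniteDimensional L.endField W₁ := Submodule.finiteDimensional_of_le hW₁W
  have hVW : Disjoint V W₁ := by
    rw [Submodule.disjoint_def]
    intro x hxV hxW₁
    have hxE : x ∈ L.towerE m := (Submodule.span_le (p := L.fieldSubmodule (L.towerE m))).2 hAE hxV
    have hxL : x ∈ L.fieldL :=
      (Submodule.span_le (p := L.fieldSubmodule L.fieldL)).2 hBL (hW₁W hxW₁)
    have hxD : x ∈ D := by
      have : x ∈ L.towerE m ⊓ L.fieldL := ⟨hxE, hxL⟩
      rwa [ih.inf_eq_bot] at this
    exact Submodule.disjoint_def.1 hDW₁ x ⟨hW₁W hxW₁, hxD⟩ hxW₁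
  obtain ⟨v, hv⟩ := L.exists_basis_notMem_lattice V
  let t := Module.finBasis L.endField W₁
  refine ⟨_, _, fun i => L.weierstrassP (v i), fun i => (t i : ℂ), ?_, ?_, ?_⟩
  rotate_left
  all_goals
    have hVs : V ≤ pts (Set.range fun i => L.weierstrassP (v i)) :=
      L.subset_of_basis_mem v fun i => Or.inr (subset_algClosureAdjoin _ ⟨i, rfl⟩)
    have hAs : (algClosureAdjoin (L.weierstrassP '' A) : Set ℂ) ⊆
        algClosureAdjoin (Set.range fun i => L.weierstrassP (v i)) := by
      refine algClosureAdjoin_subset_of_subset ?_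
      rintro _ ⟨a, ha, rfl⟩
      exact (hVs (Submodule.subset_span ha)).resolve_left (hAL a ha)
    have hWt : W ≤ L.fieldSubmodule (algClosureAdjoin (Set.range fun i => (t i : ℂ))) := by
      rw [← hW₁]
      refine sup_le (inf_le_right.trans (hD _)) (L.subset_of_basis_mem t fun i => ?_)
      exact subset_algClosureAdjoin _ ⟨i, rfl⟩
    have hBt : (algClosureAdjoin B : Set ℂ) ⊆ algClosureAdjoin (Set.range fun i => (t i : ℂ)) :=
      algClosureAdjoin_subset_of_subset fun b hb => hWt (Submodule.subset_span hb)
  · exact (Set.subset_union_left.trans hXA).trans hAs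
  · exact hZB.trans hBt
  · refine algebraicIndependent_of_card_le _ fun S hS => ?_
    have hsS : (algClosureAdjoin (Set.range fun i => L.weierstrassP (v i)) : Set ℂ) ⊆
        algClosureAdjoin (S : Set ℂ) :=
      algClosureAdjoin_subset_of_subset (by
        rintro _ ⟨i, rfl⟩; exact hS ⟨Sum.inl i, rfl⟩)
    have htS : (algClosureAdjoin (Set.range fun i => (t i : ℂ)) : Set ℂ) ⊆
        algClosureAdjoin (S : Set ℂ) :=
      algClosureAdjoin_subset_of_subset (by
        rintro _ ⟨i, rfl⟩; exact hS ⟨Sum.inr i, rfl⟩)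
    have h1 : V ⊔ W₁ ≤ L.fieldSubmodule (algClosureAdjoin (S : Set ℂ)) := by
      refine sup_le (Submodule.span_le.2 fun a ha => hsS (hAs (hXA (Or.inr ha)))) fun x hx => ?_
      exact htS (hWt (hW₁W hx))
    have h2 : V ⊔ W₁ ≤ pts (S : Set ℂ) := by
      refine sup_le (hVs.trans (L.pointsIn_mono hsS)) fun x hx => ?_
      have h3 : W ≤ pts B := Submodule.span_le.2 hBP
      exact L.pointsIn_mono (hBt.trans htS) (h3 (hW₁W hx))
    have h4 := h (V ⊔ W₁) S h1 h2
    have h5 := finrank_add_of_disjoint hVW rfl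
    rw [Fintype.card_sum, Fintype.card_fin, Fintype.card_fin]
    omega

theorem RankInequality.fieldE_linearDisjoint (h : L.RankInequality)
    (hg₂ : IsAlgebraic ℚ L.g₂) (hg₃ : IsAlgebraic ℚ L.g₃) :
    L.fieldE.LinearDisjoint L.fieldL := by
  have key (m : ℕ) : (L.towerE m).LinearDisjoint L.fieldL := by
    induction m with
    | zero => exact IntermediateField.LinearDisjoint.bot_left Qbar ℂ L.fieldL
    | succ m ih =>
      exact linearDisjoint_of_exists_algebraicIndependent fun X Z hX hZ hXE hZL =>
        h.exists_algebraicIndependent L hg₂ hg₃ ih hX hZ hXE hZL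
  refine linearDisjoint_of_exists_algebraicIndependent fun X Z hX hZ hXE hZL => ?_
  rw [coe_fieldE] at hXE
  obtain ⟨m, hm⟩ := exists_subset_of_finite_subset_iUnion (fun _ _ h => L.towerE_mono h) hX hXE
  exact h.exists_algebraicIndependent L hg₂ hg₃ (key m) hX hZ
    (hm.trans (L.towerE_mono m.le_succ)) hZL

/-! ### The Weierstrass zeta function and its quasi-periods -/

theorem summable_weierstrassZeta (z : ℂ) :
    Summable fun l : L.lattice => 1 / (z - l) + 1 / (l : ℂ) + z / (l : ℂ) ^ 2 := by
  have hs : Summable fun l : L.lattice => 2 * ‖z‖ ^ 2 * ‖l‖ ^ (-3 : ℝ) :=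
    (ZLattice.summable_norm_rpow _ _ (by simp; norm_num)).mul_left _
  refine hs.of_norm_bounded_eventually ?_
  have hfin : {l : L.lattice | ‖(l : ℂ)‖ ≤ 2 * ‖z‖}.Finite :=
    Set.Finite.of_finite_image ((L.finite_lattice_inter_closedBall (2 * ‖z‖)).subset
      (by rintro _ ⟨l, hl, rfl⟩; exact ⟨l.2, hl⟩)) Subtype.val_injective.injOn
  filter_upwards [hfin.compl_mem_cofinite] with l hl
  have hl' : 2 * ‖z‖ < ‖(l : ℂ)‖ := not_le.1 hl
  have hlpos : 0 < ‖(l : ℂ)‖ := (by positivity : 0 ≤ 2 * ‖z‖).trans_lt hl'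
  have hl0 : (l : ℂ) ≠ 0 := norm_pos_iff.1 hlpos
  have hzl : ‖(l : ℂ)‖ / 2 ≤ ‖z - l‖ := by
    rw [norm_sub_rev]
    exact .trans (by linarith) (norm_sub_norm_le _ _)
  have hzl0 : z - (l : ℂ) ≠ 0 := norm_pos_iff.1 (by linarith)
  have h1 : 1 / (z - l) + 1 / (l : ℂ) + z / (l : ℂ) ^ 2 = z ^ 2 / (l ^ 2 * (z - l)) := by
    field
  rw [h1, norm_div, norm_mul, norm_pow, norm_pow]
  calc ‖z‖ ^ 2 / (‖(l : ℂ)‖ ^ 2 * ‖z - l‖)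
      ≤ ‖z‖ ^ 2 / (‖(l : ℂ)‖ ^ 2 * (‖(l : ℂ)‖ / 2)) := by gcongr
    _ = 2 * ‖z‖ ^ 2 / ‖(l : ℂ)‖ ^ 3 := by field
    _ = _ := by rw [div_eq_mul_inv]; norm_cast

/-- Termwise differentiation of the series of `ζ` gives the series of `-℘`. -/
theorem hasDerivAt_weierstrassZeta {z : ℂ} (hz : z ∉ L.lattice) :
    HasDerivAt L.weierstrassZeta (-L.weierstrassP z) z := by
  have h1 : TendstoLocallyUniformly (fun (s : Finset L.lattice) (z : ℂ) =>
      ∑ l ∈ s, (1 / (z - ↑l) ^ 2 - 1 / (l : ℂ) ^ 2)) L.weierstrassP atTop :=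
    hasSumLocallyUniformly_iff_tendstoLocallyUniformly.1 L.hasSumLocallyUniformly_weierstrassP
  have h2 := h1.tendstoLocallyUniformlyOn (s := (L.lattice : Set ℂ)ᶜ) |>.fun_neg
  refine hasDerivAt_of_tendstoLocallyUniformlyOn (s := (L.lattice : Set ℂ)ᶜ)
    L.isClosed_lattice.isOpen_compl h2 (Eventually.of_forall fun s x hx => ?_)
    (fun x _ => (L.summable_weierstrassZeta x).hasSum) hz
  rw [← Finset.sum_neg_distrib]
  refine HasDerivAt.fun_sum fun l _ => ?_
  have hxl : x - (l : ℂ) ≠ 0 := sub_ne_zero.2 fun h => hx (h ▸ l.2)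
  have h3 := (((hasDerivAt_id x).sub_const (l : ℂ)).inv hxl).add_const (1 / (l : ℂ))
    |>.add ((hasDerivAt_id x).div_const ((l : ℂ) ^ 2))
  convert h3 using 1
  · ext y; simp
  · simp only [id]; ring

/-- The pairs `(l, c)` such that `l` is a period of `℘` and `c` the corresponding quasi-period
of `ζ`. -/
def quasiPeriods : AddSubgroup (ℂ × ℂ) where
  carrier := {p | p.1 ∈ L.lattice ∧
    ∀ z ∉ L.lattice, L.weierstrassZeta (z + p.1) = L.weierstrassZeta z + p.2}
  zero_mem' := ⟨L.lattice.zero_mem, fun z _ => by simp⟩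
  add_mem' := by
    rintro p q ⟨hp, hp'⟩ ⟨hq, hq'⟩
    refine ⟨add_mem hp hq, fun z hz => ?_⟩
    have : z + p.1 ∉ L.lattice := fun h => hz ((add_mem_cancel_right hp).1 h)
    rw [Prod.fst_add, Prod.snd_add, ← add_assoc, hq' _ this, hp' z hz, add_assoc]
  neg_mem' := by
    rintro p ⟨hp, hp'⟩
    refine ⟨neg_mem hp, fun z hz => ?_⟩
    have : z + -p.1 ∉ L.lattice := fun h => hz ((add_mem_cancel_right (neg_mem hp)).1 h)
    have h := hp' _ this
    rw [neg_add_cancel_right] at h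
    rw [Prod.fst_neg, Prod.snd_neg, h, add_neg_cancel_right]

theorem exists_mem_quasiPeriods {l : ℂ} (hl : l ∈ L.lattice) : ∃ c, (l, c) ∈ L.quasiPeriods := by
  have hmem (z : ℂ) (hz : z ∉ L.lattice) : z + l ∉ L.lattice := fun h =>
    hz ((add_mem_cancel_right hl).1 h)
  have hd (z : ℂ) (hz : z ∉ L.lattice) :
      HasDerivAt (fun z => L.weierstrassZeta (z + l) - L.weierstrassZeta z) 0 z := by
    have := ((L.hasDerivAt_weierstrassZeta (hmem z hz)).comp_add_const z l).sub
      (L.hasDerivAt_weierstrassZeta hz)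
    rwa [L.weierstrassP_add hl, sub_self] at this
  obtain ⟨c, hc⟩ := L.isClosed_lattice.isOpen_compl.exists_is_const_of_deriv_eq_zero
    (isPreconnected_compl_of_countable L.countable_lattice)
    (fun z hz => (hd z hz).differentiableAt.differentiableWithinAt) (fun z hz => (hd z hz).deriv)
  refine ⟨c, hl, fun z hz => ?_⟩
  have := hc z hz
  simp only at this ⊢
  linear_combination this

theorem quasiPeriod_mem {l : ℂ} (hl : l ∈ L.lattice) (hl2 : l / 2 ∉ L.lattice) :
    (l, L.quasiPeriod l) ∈ L.quasiPeriods := by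
  obtain ⟨c, hc⟩ := L.exists_mem_quasiPeriods hl
  have h2 : -l / 2 ∉ L.lattice := by rwa [neg_div, neg_mem_iff]
  have : L.quasiPeriod l = c := by
    rw [quasiPeriod, hc.2 _ h2, add_sub_cancel_left]
  rwa [this]

theorem mem_quasiPeriods_of_int (a b : ℤ) :
    ((a * L.ω₁ + b * L.ω₂, a * L.quasiPeriod L.ω₁ + b * L.quasiPeriod L.ω₂) : ℂ × ℂ) ∈
      L.quasiPeriods := by
  have h := add_mem
    (zsmul_mem (L.quasiPeriod_mem L.ω₁_mem_lattice L.ω₁_div_two_notMem_lattice) a)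
    (zsmul_mem (L.quasiPeriod_mem L.ω₂_mem_lattice L.ω₂_div_two_notMem_lattice) b)
  simpa using h

/-! ### Complex multiplication and quasi-periods -/

/-- The group `α⁻¹ Λ / Λ` is finite. -/
theorem exists_finset_quotient {α : ℂ} (hα : α ≠ 0) (hαL : ∀ l ∈ L.lattice, α * l ∈ L.lattice) :
    ∃ Q : Finset (ℂ ⧸ L.lattice), ∀ z : ℂ, Submodule.Quotient.mk z ∈ Q ↔ α * z ∈ L.lattice := by
  classical
  obtain ⟨S, hS, hSz⟩ := L.exists_finset_representatives (w := 0) hα hαL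
  refine ⟨S.image Submodule.Quotient.mk, fun z => ?_⟩
  rw [Finset.mem_image]
  constructor
  · rintro ⟨s, hs, hsz⟩
    have h1 := (Submodule.Quotient.eq L.lattice).1 hsz
    have h2 := sub_mem (hS s hs) (hαL _ h1)
    convert h2 using 1
    ring
  · intro hz
    obtain ⟨s, hs, hsz⟩ := hSz z (by rwa [add_zero])
    exact ⟨s, hs, ((Submodule.Quotient.eq L.lattice).2 hsz).symm⟩

theorem exists_analyticAt_weierstrassP_affine_sub {α w s : ℂ} (hα : α ≠ 0)
    (hs : α * s + w ∈ L.lattice) :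
    ∃ g : ℂ → ℂ, AnalyticAt ℂ g s ∧
      ∀ z, α ^ 2 * L.weierstrassP (α * z + w) = 1 / (z - s) ^ 2 + g z := by
  refine ⟨fun z => α ^ 2 * (L.weierstrassPExcept (α * s + w) (α * z + w) -
    1 / (α * s + w) ^ 2), ?_, fun z => ?_⟩
  · have h1 : AnalyticAt ℂ (fun z => L.weierstrassPExcept (α * s + w) (α * z + w)) s :=
      AnalyticAt.comp_of_eq (L.analyticAt_weierstrassPExcept (α * s + w)) (by fun_prop) rfl
    fun_prop
  · rw [← L.weierstrassPExcept_add ⟨_, hs⟩]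
    have h2 : α * z + w - (α * s + w) = α * (z - s) := by ring
    simp only [h2, mul_pow]
    have : α ^ 2 * (1 / (α ^ 2 * (z - s) ^ 2)) = 1 / (z - s) ^ 2 := by
      rw [one_div, mul_inv, mul_inv_cancel_left₀ (pow_ne_zero 2 hα), one_div]
    linear_combination this

/-- The distribution relation of `℘` for a multiplier `α` of the lattice: up to a constant,
`α² ℘(α z)` is the sum of the translates of `℘` by `α⁻¹ Λ / Λ`, because both sides have
the same principal parts. -/
theorem exists_sum_weierstrassP_eq {α : ℂ} (hα : α ≠ 0)
    (hαL : ∀ l ∈ L.lattice, α * l ∈ L.lattice) :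
    ∃ (Q : Finset (ℂ ⧸ L.lattice)) (κ : ℂ), (∀ q ∈ Q, α * q.out ∈ L.lattice) ∧
      ∀ z, α * z ∉ L.lattice →
        α ^ 2 * L.weierstrassP (α * z) = ∑ q ∈ Q, L.weierstrassP (z + q.out) + κ := by
  classical
  obtain ⟨Q, hQ⟩ := L.exists_finset_quotient hα hαL
  have hout (q : ℂ ⧸ L.lattice) : (Submodule.Quotient.mk q.out : ℂ ⧸ L.lattice) = q :=
    Quotient.out_eq q
  have hQout : ∀ q ∈ Q, α * q.out ∈ L.lattice := fun q hq =>
    (hQ _).1 (by rwa [hout])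
  have hPan {z : ℂ} {q : ℂ ⧸ L.lattice} (hz : z + q.out ∉ L.lattice) :
      AnalyticAt ℂ (fun z => L.weierstrassP (z + q.out)) z := by
    simpa using L.analyticAt_weierstrassP_affine (α := 1) (w := q.out) (by simpa using hz)
  let H : ℂ → ℂ := fun z => α ^ 2 * L.weierstrassP (α * z) - ∑ q ∈ Q, L.weierstrassP (z + q.out)
  have hreg {z : ℂ} (hz : α * z ∉ L.lattice) : AnalyticAt ℂ H z := by
    have h1 : AnalyticAt ℂ (fun z => L.weierstrassP (α * z)) z := by
      simpa using L.analyticAt_weierstrassP_affine (α := α) (w := 0) (by simpa using hz)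
    have h2 : AnalyticAt ℂ (fun z => ∑ q ∈ Q, L.weierstrassP (z + q.out)) z := by
      refine Finset.analyticAt_fun_sum _ fun q hq => hPan fun h => hz ?_
      have := sub_mem (hαL _ h) (hQout q hq)
      convert this using 1
      ring
    exact (analyticAt_const.mul h1).sub h2
  have hper (z : ℂ) (l : ℂ) (hl : l ∈ L.lattice) : H (z + l) = H z := by
    simp only [H, mul_add, L.weierstrassP_add (hαL l hl)]
    congr 1
    refine Finset.sum_congr rfl fun q _ => ?_
    rw [add_right_comm, L.weierstrassP_add hl]
  obtain ⟨κ, hκ⟩ := L.exists_eq_const_of_periodic hper fun s => by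
    by_cases hs : α * s ∈ L.lattice
    · -- exactly one translate has a pole at `s`
      let q₀ : ℂ ⧸ L.lattice := Submodule.Quotient.mk (-s)
      have hq₀ : q₀ ∈ Q := (hQ _).2 (by rw [mul_neg]; exact neg_mem hs)
      have hpole {q : ℂ ⧸ L.lattice} : s + q.out ∈ L.lattice ↔ q = q₀ := by
        rw [← hout q, Submodule.Quotient.eq, hout, sub_neg_eq_add, add_comm]
      obtain ⟨g₁, hg₁, h₁⟩ := L.exists_analyticAt_weierstrassP_affine_sub (w := 0) hα
        (s := s) (by simpa using hs)
      obtain ⟨g₂, hg₂, h₂⟩ := L.exists_analyticAt_weierstrassP_affine_sub (α := 1) one_ne_zero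
        (w := q₀.out) (s := s) (by rw [one_mul]; exact hpole.2 rfl)
      have h3 : AnalyticAt ℂ (fun z => ∑ q ∈ Q.erase q₀, L.weierstrassP (z + q.out)) s :=
        Finset.analyticAt_fun_sum _ fun q hq => hPan fun h => Finset.ne_of_mem_erase hq (hpole.1 h)
      refine ⟨fun z => g₁ z - g₂ z - ∑ q ∈ Q.erase q₀, L.weierstrassP (z + q.out),
        (hg₁.sub hg₂).sub h3, Eventually.of_forall fun z => ?_⟩
      have e1 := h₁ z
      have e2 := h₂ z
      simp only [add_zero] at e1
      simp only [one_mul, one_pow] at e2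
      simp only [H]
      rw [← Finset.add_sum_erase Q _ hq₀, e1, e2]
      ring
    · exact ⟨H, hreg hs, EventuallyEq.rfl⟩
  refine ⟨Q, κ, hQout, fun z hz => ?_⟩
  rw [← hκ z (hreg hz).continuousAt]
  simp only [H]
  ring

/-- Integration of the distribution relation of `℘` gives one for `ζ`, and its increments along
periods give a linear relation between the quasi-periods of `l` and `α l`, with an algebraic
coefficient `κ`. -/
theorem exists_multiplier_relation_quasiPeriods {α : ℂ} (hα : α ≠ 0)
    (hαL : ∀ l ∈ L.lattice, α * l ∈ L.lattice) (hg₂ : IsAlgebraic ℚ L.g₂)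
    (hg₃ : IsAlgebraic ℚ L.g₃) :
    ∃ (N : ℕ) (κ : ℂ), IsAlgebraic ℚ κ ∧ ∀ l c c' : ℂ, (l, c) ∈ L.quasiPeriods →
      (α * l, c') ∈ L.quasiPeriods → α * c' = N * c - κ * l := by
  obtain ⟨Q, κ, hQ, hκ⟩ := L.exists_sum_weierstrassP_eq hα hαL
  have hshift {z : ℂ} (hz : α * z ∉ L.lattice) {q} (hq : q ∈ Q) : z + q.out ∉ L.lattice :=
    fun h => hz (by simpa [mul_add] using sub_mem (hαL _ h) (hQ q hq))
  refine ⟨Q.card, κ, ?_, fun l c c' hc hc' => ?_⟩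
  · -- evaluate the relation at a point of finite order
    let F : IntermediateField Qbar ℂ := algClosureAdjoin ∅
    let P := L.pointsSubmodule (mem_algClosureAdjoin_closed ∅)
      (mem_of_isAlgebraic_rat F hg₂) (mem_of_isAlgebraic_rat F hg₃)
    have hF {x : ℂ} (hx : α * x ∈ P) : x ∈ P :=
      L.mem_pointsIn_of_mul_mem (mem_algClosureAdjoin_closed ∅)
        (mem_of_isAlgebraic_rat F hg₂) (mem_of_isAlgebraic_rat F hg₃) hα hαL hx
    have hhalf : L.ω₁ / 2 ∈ P := L.half_mem_pointsIn (mem_algClosureAdjoin_closed ∅)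
        (mem_of_isAlgebraic_rat F hg₂) (mem_of_isAlgebraic_rat F hg₃) L.ω₁_mem_lattice
    have hz : α * (L.ω₁ / 2 / α) = L.ω₁ / 2 := mul_div_cancel₀ _ hα
    have hzP : L.ω₁ / 2 / α ∈ P := hF (by rwa [hz])
    have hzL : α * (L.ω₁ / 2 / α) ∉ L.lattice := by
      rw [hz]; exact L.ω₁_div_two_notMem_lattice
    have h1 := hκ _ hzL
    have hκF : κ ∈ F := by
      rw [← sub_eq_iff_eq_add'] at h1
      rw [← h1]
      refine sub_mem (mul_mem (pow_mem (mem_of_isAlgebraic_rat F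
        (L.isAlgebraic_of_mul_lattice hαL)) 2) ?_) (sum_mem fun q hq => ?_)
      · rw [hz]; exact Or.resolve_left hhalf L.ω₁_div_two_notMem_lattice
      · have : L.ω₁ / 2 / α + q.out ∈ P := add_mem hzP (hF (Or.inl (hQ q hq)))
        exact Or.resolve_left this (hshift hzL hq)
    have : κ ∈ (algClosureAdjoin ∅ : Set ℂ) := hκF
    rw [coe_algClosureAdjoin_empty] at this
    exact isAlgebraic_rat_of_mem_bot this
  · let D : Set ℂ := {z | α * z ∈ L.lattice}ᶜ
    have hDc : {z : ℂ | α * z ∈ L.lattice}.Countable :=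
      L.countable_lattice.preimage (mul_right_injective₀ hα)
    have hDo : IsOpen D := (L.isClosed_lattice.preimage (continuous_const_mul α)).isOpen_compl
    let G : ℂ → ℂ := fun z => α * L.weierstrassZeta (α * z) -
      ∑ q ∈ Q, L.weierstrassZeta (z + q.out) + κ * z
    have hG {z : ℂ} (hz : z ∈ D) : HasDerivAt G 0 z := by
      have h1 := ((L.hasDerivAt_weierstrassZeta hz).comp z
        ((hasDerivAt_id z).const_mul α)).const_mul α
      have h2 : HasDerivAt (fun z => ∑ q ∈ Q, L.weierstrassZeta (z + q.out))
          (∑ q ∈ Q, -L.weierstrassP (z + q.out)) z :=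
        HasDerivAt.fun_sum fun q hq =>
          (L.hasDerivAt_weierstrassZeta (hshift hz hq)).comp_add_const z _
      refine ((h1.sub h2).add ((hasDerivAt_id z).const_mul κ)).congr_deriv ?_
      rw [Finset.sum_neg_distrib]
      linear_combination -hκ z hz
    obtain ⟨C, hC⟩ := hDo.exists_is_const_of_deriv_eq_zero (isPreconnected_compl_of_countable hDc)
      (fun z hz => (hG hz).differentiableAt.differentiableWithinAt) (fun z hz => (hG hz).deriv)
    obtain ⟨z, hz⟩ : D.Nonempty := ⟨L.ω₁ / 2 / α, by
      change α * _ ∉ L.lattice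
      rw [mul_div_cancel₀ _ hα]
      exact L.ω₁_div_two_notMem_lattice⟩
    have hzl : z + l ∈ D := fun h => hz (by simpa [mul_add] using sub_mem h (hαL l hc.1))
    have e1 : G (z + l) = G z := (hC _ hzl).trans (hC _ hz).symm
    have e2 : ∑ q ∈ Q, L.weierstrassZeta (z + l + q.out) =
        ∑ q ∈ Q, L.weierstrassZeta (z + q.out) + Q.card * c := by
      rw [← nsmul_eq_mul, ← Finset.sum_const, ← Finset.sum_add_distrib]
      refine Finset.sum_congr rfl fun q hq => ?_
      rw [add_right_comm]
      exact hc.2 _ (hshift hz hq)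
    have e3 := hc'.2 _ hz
    simp only [G, e2, mul_add] at e1
    simp only at e3
    rw [e3] at e1
    linear_combination e1

/-! ### The elliptic Schanuel conjecture implies the rank inequality -/

theorem span_lattice_eq : Submodule.span L.endField (L.lattice : Set ℂ) =
    Submodule.span L.endField {L.ω₁, L.ω₂} := by
  refine le_antisymm (Submodule.span_le.2 fun l hl => ?_) (Submodule.span_mono ?_)
  · obtain ⟨a, b, rfl⟩ := mem_lattice.1 hl
    rw [← zsmul_eq_mul, ← zsmul_eq_mul]
    exact add_mem (zsmul_mem (Submodule.subset_span (by simp)) a)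
      (zsmul_mem (Submodule.subset_span (by simp)) b)
  · rintro _ (rfl | rfl)
    exacts [L.ω₁_mem_lattice, L.ω₂_mem_lattice]

instance : FiniteDimensional L.endField (Submodule.span L.endField (L.lattice : Set ℂ)) := by
  rw [span_lattice_eq]
  exact FiniteDimensional.span_of_finite _ (Set.toFinite _)

/-- A lattice with a multiplier `α ∉ ℚ` has complex multiplication by `ℚ(α)`. -/
theorem endField_eq_adjoin {α : ℂ} {a b : ℤ} (hαL : ∀ l ∈ L.lattice, α * l ∈ L.lattice)
    (hab : α * L.ω₁ = a * L.ω₁ + b * L.ω₂) (hb : b ≠ 0) :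
    L.endField = IntermediateField.adjoin ℚ {α} := by
  have hb' : (b : ℂ) ≠ 0 := Int.cast_ne_zero.2 hb
  refine le_antisymm (IntermediateField.adjoin_le_iff.2 fun β hβ => ?_)
    (IntermediateField.adjoin.mono _ _ _ (Set.singleton_subset_iff.2 hαL))
  obtain ⟨c, d, hcd⟩ := mem_lattice.1 (hβ _ L.ω₁_mem_lattice)
  have hβα : β = c + d * ((α - a) / b) := by
    refine mul_right_cancel₀ L.ω₁_ne_zero ?_
    field_simp
    linear_combination (-b : ℂ) * hcd - d * hab
  rw [hβα]
  have hα := IntermediateField.mem_adjoin_simple_self ℚ α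
  exact add_mem (intCast_mem _ c) (mul_mem (intCast_mem _ d)
    (div_mem (sub_mem hα (intCast_mem _ a)) (intCast_mem _ b)))

open Polynomial in
/-- With `t = 2 / [K : ℚ]`, the span of the lattice over the field `K` of endomorphisms has
dimension at most `t`, and both quasi-periods are algebraic over the periods and `t` numbers.
Without complex multiplication this is trivial; with it, the relation between the quasi-periods is
needed. -/
theorem exists_finset_quasiPeriod (hg₂ : IsAlgebraic ℚ L.g₂) (hg₃ : IsAlgebraic ℚ L.g₃) :
    FiniteDimensional ℚ L.endField ∧ ∃ (t : ℕ) (E : Finset ℂ), E.card ≤ t ∧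
      Module.finrank L.endField (Submodule.span L.endField (L.lattice : Set ℂ)) ≤ t ∧
      2 * t ≤ 4 / Module.finrank ℚ L.endField ∧
      ({L.quasiPeriod L.ω₁, L.quasiPeriod L.ω₂} : Set ℂ) ⊆
        algClosureAdjoin ((L.lattice : Set ℂ) ∪ E) := by
  classical
  by_cases h : ∀ α : ℂ, (∀ l ∈ L.lattice, α * l ∈ L.lattice) → ∃ r : ℚ, (r : ℂ) = α
  · have hK : L.endField = ⊥ := by
      refine le_bot_iff.1 (IntermediateField.adjoin_le_iff.2 fun α hα => ?_)
      obtain ⟨r, hr⟩ := h α hα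
      exact IntermediateField.mem_bot.2 ⟨r, by rw [← hr, eq_ratCast]⟩
    have hK1 : Module.finrank ℚ L.endField = 1 := by rw [hK, IntermediateField.finrank_bot]
    refine ⟨Module.finite_of_finrank_pos (by omega), 2,
      {L.quasiPeriod L.ω₁, L.quasiPeriod L.ω₂}, Finset.card_le_two, ?_, by rw [hK1], ?_⟩
    · rw [span_lattice_eq]
      refine (finrank_span_le_card _).trans ?_
      rw [Set.toFinset_insert, Set.toFinset_singleton]
      exact Finset.card_le_two
    · refine fun x hx => subset_algClosureAdjoin _ (Or.inr ?_)
      simpa using hx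
  · push Not at h
    obtain ⟨α, hαL, hαQ⟩ := h
    obtain ⟨a, b, t, n, hab, hquad⟩ := L.exists_int_quadratic hαL
    have hα0 : α ≠ 0 := fun h0 => hαQ 0 (by simp [h0])
    have hb : b ≠ 0 := by
      rintro rfl
      refine hαQ a (mul_right_cancel₀ L.ω₁_ne_zero ?_)
      rw [hab]
      simp
    have hb' : (b : ℂ) ≠ 0 := Int.cast_ne_zero.2 hb
    have hint : IsIntegral ℚ α := (L.isAlgebraic_of_mul_lattice hαL).isIntegral
    have hK := L.endField_eq_adjoin hαL hab hb
    have hfd : FiniteDimensional ℚ L.endField := by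
      rw [hK]; exact IntermediateField.adjoin.finiteDimensional hint
    have hpos : 0 < Module.finrank ℚ L.endField := Module.finrank_pos
    have hle : Module.finrank ℚ L.endField ≤ 2 := by
      rw [hK, IntermediateField.adjoin.finrank hint]
      have hdeg : (X ^ 2 + (C (-t : ℚ) * X + C (n : ℚ)) : ℚ[X]).natDegree ≤ 2 := by
        compute_degree
      have hmonic : (X ^ 2 + (C (-t : ℚ) * X + C (n : ℚ)) : ℚ[X]).Monic := by
        monicity!
      refine (natDegree_le_natDegree (minpoly.min ℚ α hmonic ?_)).trans hdeg
      have : (aeval α) (X ^ 2 + (C (-t : ℚ) * X + C (n : ℚ)) : ℚ[X]) =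
          α ^ 2 + (-(t : ℂ) * α + n) := by simp
      rw [this]
      linear_combination hquad
    refine ⟨hfd, 1, {L.quasiPeriod L.ω₁}, by simp, ?_, ?_, ?_⟩
    · -- the span is generated by `ω₁`, because `b ω₂ = (α - a) ω₁`
      have hα : α ∈ L.endField := IntermediateField.subset_adjoin _ _ hαL
      have hk : (α - a) / b ∈ L.endField :=
        div_mem (sub_mem hα (intCast_mem _ a)) (intCast_mem _ b)
      have hspan : Submodule.span L.endField (L.lattice : Set ℂ) ≤
          Submodule.span L.endField {L.ω₁} := by
        rw [span_lattice_eq, Submodule.span_le]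
        rintro _ (rfl | rfl)
        · exact Submodule.mem_span_singleton_self _
        · refine Submodule.mem_span_singleton.2 ⟨⟨_, hk⟩, ?_⟩
          change (α - a) / b * L.ω₁ = L.ω₂
          field_simp
          linear_combination hab
      exact (Submodule.finrank_mono hspan).trans (finrank_span_singleton L.ω₁_ne_zero).le
    · have : Module.finrank ℚ L.endField = 1 ∨ Module.finrank ℚ L.endField = 2 := by omega
      rcases this with h | h <;> simp [h]
    · obtain ⟨N, κ, hκ, hrel⟩ := L.exists_multiplier_relation_quasiPeriods hα0 hαL hg₂ hg₃
      have h1 := hrel L.ω₁ _ _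
        (L.quasiPeriod_mem L.ω₁_mem_lattice L.ω₁_div_two_notMem_lattice)
        (by rw [hab]; exact L.mem_quasiPeriods_of_int a b)
      let F := algClosureAdjoin ((L.lattice : Set ℂ) ∪ ({L.quasiPeriod L.ω₁} : Finset ℂ))
      have hη : L.quasiPeriod L.ω₁ ∈ F := subset_algClosureAdjoin _ (Or.inr (by simp))
      have hω : L.ω₁ ∈ F := subset_algClosureAdjoin _ (Or.inl L.ω₁_mem_lattice)
      have hαF : α ∈ F := mem_of_isAlgebraic_rat F (L.isAlgebraic_of_mul_lattice hαL)
      have h2 : L.quasiPeriod L.ω₂ =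
          ((N * L.quasiPeriod L.ω₁ - κ * L.ω₁) / α - a * L.quasiPeriod L.ω₁) / b := by
        field_simp
        linear_combination h1
      rintro _ (rfl | rfl)
      · exact hη
      · rw [h2]
        exact div_mem (sub_mem (div_mem (sub_mem (mul_mem (natCast_mem F N) hη)
          (mul_mem (mem_of_isAlgebraic_rat F hκ) hω)) hαF) (mul_mem (intCast_mem F a) hη))
          (intCast_mem F b)

/-- The field `Q̄` has infinite degree over `ℚ`, so it is not contained in a finite-dimensional
space over a number field. -/
theorem exists_isAlgebraic_notMem [FiniteDimensional ℚ L.endField] (Y : Submodule L.endField ℂ)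
    [FiniteDimensional L.endField Y] : ∃ x : ℂ, IsAlgebraic ℚ x ∧ x ∉ Y := by
  by_contra! h
  have : FiniteDimensional ℚ Y := FiniteDimensional.trans ℚ L.endField Y
  let f : Qbar →ₗ[ℚ] Y :=
    { toFun := fun x => ⟨x, h x (mem_algebraicClosure_iff.1 x.2)⟩
      map_add' := fun _ _ => rfl
      map_smul' := fun _ _ => rfl }
  have hf : Function.Injective f := fun x y hxy => Subtype.ext (congrArg (fun z : Y => (z : ℂ)) hxy)
  have : FiniteDimensional ℚ Qbar := FiniteDimensional.of_injective f hf
  -- a primitive `p`-th root of unity has degree `p - 1`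
  obtain ⟨p, hp, hprime⟩ := Nat.exists_infinite_primes (Module.finrank ℚ Qbar + 2)
  have hζ := Complex.isPrimitiveRoot_exp p hprime.ne_zero
  have hint : IsIntegral ℚ (Complex.exp (2 * Real.pi * Complex.I / p)) :=
    (hζ.isIntegral hprime.pos).tower_top
  let x : Qbar := ⟨_, mem_algebraicClosure_iff.2 hint.isAlgebraic⟩
  have h1 : (minpoly ℚ x).natDegree ≤ Module.finrank ℚ Qbar := minpoly.natDegree_le x
  have h2 : minpoly ℚ x = minpoly ℚ (Complex.exp (2 * Real.pi * Complex.I / p)) :=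
    (minpoly.algebraMap_eq (algebraMap Qbar ℂ).injective x).symm
  rw [h2, ← Polynomial.cyclotomic_eq_minpoly_rat hζ hprime.pos, Polynomial.natDegree_cyclotomic,
    Nat.totient_prime hprime] at h1
  omega

/-- The conjecture for a basis of `Y` modulo the span `T` of the lattice. The contribution
`4 / [K : ℚ]` to the transcendence degree pays for the quasi-periods and for the intersection of
`Y` with `T`. An algebraic point `x₀ ∉ Y + T` is adjoined so that the family is never empty; it
raises the dimension by one and needs only the additional generators `℘(x₀)` and one value of
`ζ`. -/
theorem EllipticSchanuel.rankInequality (h : L.EllipticSchanuel) (hg₂ : IsAlgebraic ℚ L.g₂)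
    (hg₃ : IsAlgebraic ℚ L.g₃) : L.RankInequality := by
  classical
  obtain ⟨hK, t, E, hE, ht, ht', hη⟩ := L.exists_finset_quasiPeriod hg₂ hg₃
  intro Y _ S hY hYP
  let T := Submodule.span L.endField (L.lattice : Set ℂ)
  obtain ⟨x₀, hx₀, hx₀Y⟩ := L.exists_isAlgebraic_notMem (Y ⊔ T)
  let Y' := (Y ⊔ T) ⊔ Submodule.span L.endField {x₀}
  have hx₀0 : x₀ ≠ 0 := fun h0 => hx₀Y (h0 ▸ zero_mem _)
  have hx₀d : Disjoint (Y ⊔ T) (Submodule.span L.endField {x₀}) :=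
    (Submodule.disjoint_span_singleton' hx₀0).2 hx₀Y
  have hY'dim := finrank_add_of_disjoint hx₀d (B := Y') rfl
  rw [finrank_span_singleton hx₀0] at hY'dim
  -- generators of `Y + T` over `Y`, and representatives of a basis of `Y' / T`
  obtain ⟨C, hYC, hC⟩ := exists_disjoint_sup_eq (le_sup_left : Y ≤ Y ⊔ T)
  obtain ⟨W, hTW, hW⟩ := exists_disjoint_sup_eq (le_sup_right.trans le_sup_left : T ≤ Y')
  have hCdim := finrank_add_of_disjoint hYC hC
  have hWdim := finrank_add_of_disjoint hTW hW
  have : FiniteDimensional L.endField C :=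
    Submodule.finiteDimensional_of_le (le_sup_right.trans hC.le)
  have : FiniteDimensional L.endField W :=
    Submodule.finiteDimensional_of_le (le_sup_right.trans hW.le)
  let c := Module.finBasis L.endField C
  let x := Module.finBasis L.endField W
  have hTle : Module.finrank L.endField T ≤ Module.finrank L.endField (Y ⊔ T : Submodule _ _) :=
    Submodule.finrank_mono le_sup_right
  have hxL (i) : (x i : ℂ) ∉ L.lattice := fun hi => x.ne_zero i (Subtype.ext
    (Submodule.disjoint_def.1 hTW _ (Submodule.subset_span hi) (x i).2))
  have hxlin : LinearIndependent L.endField (fun i => T.mkQ (x i : ℂ)) := by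
    have h1 := x.linearIndependent.map' W.subtype (Submodule.ker_subtype W)
    refine h1.map (f := T.mkQ) ?_
    rw [Submodule.ker_mkQ]
    refine hTW.symm.mono_left (Submodule.span_le.2 ?_)
    rintro _ ⟨i, rfl⟩
    exact (x i).2
  let S' : Finset ℂ := S ∪ Finset.univ.image (fun i => (c i : ℂ)) ∪ {L.weierstrassP x₀} ∪ E ∪
    Finset.univ.image (fun i => L.weierstrassZeta (x i))
  have hcard : S'.card ≤ S.card + Module.finrank L.endField C + 1 + t +
      Module.finrank L.endField W := by
    refine (Finset.card_union_le _ _).trans (add_le_add ?_ (Finset.card_image_le.trans (by simp)))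
    refine (Finset.card_union_le _ _).trans (add_le_add ?_ hE)
    refine (Finset.card_union_le _ _).trans (add_le_add ?_ (by simp))
    exact (Finset.card_union_le _ _).trans (add_le_add le_rfl
      (Finset.card_image_le.trans (by simp)))
  let F := algClosureAdjoin (S' : Set ℂ)
  have hSS' : (S : Set ℂ) ⊆ S' := fun y hy => by
    simp only [S', Finset.mem_coe, Finset.mem_union]; tauto
  have hES' : (E : Set ℂ) ⊆ S' := fun y hy => by
    simp only [S', Finset.mem_coe, Finset.mem_union]; tauto
  have hYF : (algClosureAdjoin (S : Set ℂ) : Set ℂ) ⊆ F := algClosureAdjoin_mono hSS'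
  have hYTF : Y ⊔ T ≤ L.fieldSubmodule F := by
    rw [← hC]
    refine sup_le (hY.trans hYF) (L.subset_of_basis_mem c fun i => ?_)
    exact subset_algClosureAdjoin _ (by simp [S'])
  have hY'F : Y' ≤ L.fieldSubmodule F := by
    refine sup_le hYTF (Submodule.span_le.2 (Set.singleton_subset_iff.2 ?_))
    exact mem_of_isAlgebraic_rat F hx₀
  let P := L.pointsSubmodule (mem_algClosureAdjoin_closed (S' : Set ℂ))
    (mem_of_isAlgebraic_rat F hg₂) (mem_of_isAlgebraic_rat F hg₃)
  have hY'P : Y' ≤ P := by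
    refine sup_le (sup_le (hYP.trans (L.pointsIn_mono hYF))
      (Submodule.span_le.2 fun l hl => Or.inl hl))
      (Submodule.span_le.2 (Set.singleton_subset_iff.2 (Or.inr ?_)))
    exact subset_algClosureAdjoin _ (by simp [S'])
  have hWY' : W ≤ Y' := le_sup_right.trans hW.le
  have hlF : (L.lattice : Set ℂ) ⊆ F := fun l hl =>
    hYTF (le_sup_right (a := Y) (Submodule.subset_span hl))
  have hηF : ({L.quasiPeriod L.ω₁, L.quasiPeriod L.ω₂} : Set ℂ) ⊆ F :=
    hη.trans (algClosureAdjoin_subset_of_subset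
      (Set.union_subset hlF (hES'.trans (subset_algClosureAdjoin _))))
  have h1 := h _ (fun i => (x i : ℂ)) (by omega) hxL hxlin
  have h2 := h1.trans (trdeg_adjoin_le (S := S') ?_)
  · have h3 := Nat.cast_le.1 h2
    change Module.finrank L.endField T ≤ t at ht
    omega
  · rintro y (((hy | ⟨i, rfl⟩) | ⟨i, rfl⟩) | ⟨i, rfl⟩)
    · rcases hy with rfl | rfl | rfl | rfl | hy
      · exact mem_of_isAlgebraic_rat F hg₂
      · exact mem_of_isAlgebraic_rat F hg₃
      · exact hlF L.ω₁_mem_lattice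
      · exact hlF L.ω₂_mem_lattice
      · exact hηF hy
    · exact hY'F (hWY' (x i).2)
    · exact Or.resolve_left (hY'P (hWY' (x i).2)) (hxL i)
    · exact subset_algClosureAdjoin _ (by simp [S'])

end PeriodPair

theorem corollary3 (L : PeriodPair) (hg₂ : IsAlgebraic ℚ L.g₂) (hg₃ : IsAlgebraic ℚ L.g₃)
    (hS : L.EllipticSchanuel ∨ L.WeakEllipticSchanuel) :
    L.fieldE.LinearDisjoint L.fieldL ∧
      ∀ ω ∈ L.lattice, ω ≠ 0 → ω ∉ L.fieldE := by
  have hR : L.RankInequality :=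
    hS.elim (fun h => h.rankInequality L hg₂ hg₃) (fun h => h.rankInequality L hg₂ hg₃)
  have hdisj := hR.fieldE_linearDisjoint L hg₂ hg₃
  refine ⟨hdisj, fun ω hω hω0 hωE => ?_⟩
  have hωL : ω ∈ L.fieldL :=
    le_iSup L.towerL 0 (subset_algClosureAdjoin (L.lattice : Set ℂ) hω)
  have hbot : ω ∈ L.fieldE ⊓ L.fieldL := ⟨hωE, hωL⟩
  rw [hdisj.inf_eq_bot] at hbot
  exact hR.not_isAlgebraic_period L hg₂ hg₃ hω hω0 (isAlgebraic_rat_of_mem_bot hbot)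

end
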